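/- Let $M(n)$ be the law of the random symmetric $n\times n$ real matrix with zero diagonal and i.i.d. standard Gaussian entries above the diagonal. For $g\in\mathbb{R}^n$ let $\Delta(g)=gg^\top-\mathrm{diag}(gg^\top)$, i.e. $gg^\top$ with its diagonal removed. For $u\in[0,1]$ let $M(n,u)$ be the law of $$u\,\Delta(g)+\sqrt{1-u^2}\,M',$$ where $g\sim\mathcal{N}(0,I_n)$ and $M'\sim M(n)$ are independent. Let $\mathsf{TV}(\nu,\mu)=\sup_A|\nu(A)-\mu(A)|$ (supremum over measurable sets $A$) denote the total variation distance between probability measures. Then there is an absolute constant $C>0$ such that for every $n$ and every $u\in[0,1]$, $$\mathsf{TV}(M(n,u),M(n))\le C\,u^3n^{3/2}.$$ -/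

import Mathlib

open MeasureTheory ProbabilityTheory

noncomputable section

/-- Total variation distance of two probability measures, `sup_A |ν(A) - μ(A)|` over all
measurable sets `A`. -/
def tvDist {Ω : Type*} [MeasurableSpace Ω] (ν μ : Measure Ω) : ℝ :=
  ⨆ A : {A : Set Ω // MeasurableSet A}, |ν.real A.1 - μ.real A.1|

/-- The product (Borel) σ-algebra on real matrices, entry by entry. -/
instance instMeasurableSpaceRealMatrix (n : ℕ) :
    MeasurableSpace (Matrix (Fin n) (Fin n) ℝ) :=
  inferInstanceAs (MeasurableSpace (Fin n → Fin n → ℝ))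

/-- The symmetric `n × n` matrix with zero diagonal whose entries above the diagonal are `x`. -/
def symmOfUpper (n : ℕ) (x : {p : Fin n × Fin n // p.1 < p.2} → ℝ) :
    Matrix (Fin n) (Fin n) ℝ :=
  Matrix.of fun i j =>
    if h : i < j then x ⟨(i, j), h⟩ else if h : j < i then x ⟨(j, i), h⟩ else 0

/-- `M(n)`: the law of the symmetric `n × n` matrix with zero diagonal and i.i.d. standard
Gaussian entries above the diagonal. -/
def goeLaw (n : ℕ) : Measure (Matrix (Fin n) (Fin n) ℝ) :=
  (Measure.pi fun _ : {p : Fin n × Fin n // p.1 < p.2} => gaussianReal 0 1).map (symmOfUpper n)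

/-- `Δ(g) = g gᵀ - diag(g gᵀ)`. -/
def offDiagSpike {n : ℕ} (g : Fin n → ℝ) : Matrix (Fin n) (Fin n) ℝ :=
  Matrix.vecMulVec g g - Matrix.diagonal (Matrix.diag (Matrix.vecMulVec g g))

/-- The standard Gaussian law `N(0, I_n)`: `n` i.i.d. standard Gaussian coordinates. -/
def stdGaussianVec (n : ℕ) : Measure (Fin n → ℝ) :=
  Measure.pi fun _ => gaussianReal 0 1

/-- `M(n, u)`: the law of `u Δ(g) + √(1 - u²) M'` with `g ∼ N(0, I_n)` and `M' ∼ M(n)`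
independent. -/
def spikedGoeLaw (n : ℕ) (u : ℝ) : Measure (Matrix (Fin n) (Fin n) ℝ) :=
  ((stdGaussianVec n).prod (goeLaw n)).map
    fun p => u • offDiagSpike p.1 + Real.sqrt (1 - u ^ 2) • p.2

lemma measurable_symmOfUpper (n : ℕ) : Measurable (symmOfUpper n) := by
  refine measurable_pi_lambda _ fun i => measurable_pi_lambda _ fun j => ?_
  simp only [symmOfUpper, Matrix.of_apply]
  split_ifs <;> fun_prop

lemma measurable_spikedGoe (n : ℕ) (u : ℝ) :
    Measurable fun p : (Fin n → ℝ) × Matrix (Fin n) (Fin n) ℝ =>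
      u • offDiagSpike p.1 + Real.sqrt (1 - u ^ 2) • p.2 := by
  refine measurable_pi_lambda _ fun i => measurable_pi_lambda _ fun j => ?_
  have h2 : Measurable fun p : (Fin n → ℝ) × Matrix (Fin n) (Fin n) ℝ => p.2 i j :=
    (measurable_pi_apply j).comp ((measurable_pi_apply i).comp measurable_snd)
  simp only [offDiagSpike, Matrix.add_apply, Matrix.smul_apply, Matrix.sub_apply,
    Matrix.vecMulVec_apply, Matrix.diagonal_apply, Matrix.diag_apply, smul_eq_mul]
  split_ifs <;> fun_prop

instance isProbabilityMeasure_goeLaw (n : ℕ) : IsProbabilityMeasure (goeLaw n) :=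
  Measure.isProbabilityMeasure_map (measurable_symmOfUpper n).aemeasurable

instance isProbabilityMeasure_stdGaussianVec (n : ℕ) :
    IsProbabilityMeasure (stdGaussianVec n) := by
  unfold stdGaussianVec; infer_instance

instance isProbabilityMeasure_spikedGoeLaw (n : ℕ) (u : ℝ) :
    IsProbabilityMeasure (spikedGoeLaw n u) :=
  Measure.isProbabilityMeasure_map (measurable_spikedGoe n u).aemeasurable

end

/-! Given `g`, the entries above the diagonal of the spiked matrix are independent with laws `N(u θ,
1 - u²)`, where `θ` is the entry of `Δ(g)`. So the spiked law is a mixture over `g` of explicit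
densities relative to the null law, and a second moment bound controls the distance. Mehler's kernel
(`lintegral_spikeRatio_mul_le`) bounds the second moment for two spikes by `exp T`, with `T = (1 -
r²)⁻¹ (r X - r² Y)`, `r = u²`, `X` the inner product of the two spikes and `Y` their half sum of
squares, centred.

The rate comes from a cancellation. Let `N` be the number of entries above the diagonal. Then `E X =
0`, `E X² = N` and `E Y = N / 2`, so in `E (T + T² / 2)` the terms of order `r² N` cancel: the
factor `√(1 - u²)` keeps the variance of each entry equal to one. What remains is `O((r n)³)`
(`integral_spikeTaylor_le`), and its square root is of order `u³ n^(3/2)`.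

The Taylor remainder needs exponential moments of `r ⟨g, g'⟩²`, which are finite for fixed `g` only
if `r |g|²` is small. Hence spikes are restricted to `shortSpikes`. The discarded mass is also `O((r
n)³)`, and `abs_mixture_sub_le` admits such a truncation. `exists_truncated_second_moment_le`
combines these estimates. -/

/-! ### Densities of product measures. -/

/-- Fubini for the lower integral of a product of functions of the separate coordinates. -/
lemma lintegral_pi_prod_eq_prod {ι : Type*} [Fintype ι] {X : ι → Type*}
    [∀ i, MeasurableSpace (X i)] (μ : ∀ i, Measure (X i)) [∀ i, IsProbabilityMeasure (μ i)]
    {f : ∀ i, X i → ENNReal} (hf : ∀ i, Measurable (f i)) :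
    ∫⁻ x, ∏ i, f i (x i) ∂Measure.pi μ = ∏ i, ∫⁻ t, f i t ∂μ i := by
  have hind : iIndepFun (fun i (x : ∀ i, X i) => f i (x i)) (Measure.pi μ) :=
    iIndepFun_pi fun i => (hf i).aemeasurable
  have h := lintegral_prod_eq_prod_lintegral_of_indepFun Finset.univ _ hind
    (fun i => (hf i).comp (measurable_pi_apply i))
  rw [h]
  refine Finset.prod_congr rfl fun i _ => ?_
  exact (measurePreserving_eval μ i).lintegral_comp (hf i)

/-- A product of measures with densities has the product density. -/
lemma pi_withDensity_eq {ι : Type*} [Fintype ι] {X : ι → Type*}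
    [∀ i, MeasurableSpace (X i)] (μ : ∀ i, Measure (X i)) [∀ i, IsProbabilityMeasure (μ i)]
    {f : ∀ i, X i → ENNReal} (hf : ∀ i, Measurable (f i))
    [∀ i, SigmaFinite ((μ i).withDensity (f i))] :
    Measure.pi (fun i => (μ i).withDensity (f i)) =
      (Measure.pi μ).withDensity fun x => ∏ i, f i (x i) := by
  refine Measure.pi_eq fun s hs => ?_
  rw [withDensity_apply _ (MeasurableSet.univ_pi hs),
    ← lintegral_indicator (MeasurableSet.univ_pi hs)]
  have h : ∀ x : ∀ i, X i, (Set.univ.pi s).indicator (fun x => ∏ i, f i (x i)) x =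
      ∏ i, (s i).indicator (f i) (x i) := by
    intro x
    by_cases hx : x ∈ Set.univ.pi s
    · rw [Set.indicator_of_mem hx]
      refine Finset.prod_congr rfl fun i _ => ?_
      rw [Set.indicator_of_mem (hx i trivial)]
    · rw [Set.indicator_of_notMem hx]
      obtain ⟨i, hi⟩ : ∃ i, x i ∉ s i := by simpa [Set.mem_pi] using hx
      rw [Finset.prod_eq_zero (Finset.mem_univ i) (Set.indicator_of_notMem hi _)]
  simp_rw [h]
  rw [lintegral_pi_prod_eq_prod μ fun i => (hf i).indicator (hs i)]
  refine Finset.prod_congr rfl fun i _ => ?_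
  rw [withDensity_apply _ (hs i), lintegral_indicator (hs i)]

/-! ### Gaussian likelihood ratios and Mehler's kernel. -/

/-- The likelihood ratio of `N(u θ, 1 - u²)` with respect to `N(0, 1)` at `x`. -/
noncomputable def spikeRatio (u θ x : ℝ) : ℝ :=
  (√(1 - u ^ 2))⁻¹ * Real.exp (x ^ 2 / 2 - (x - u * θ) ^ 2 / (2 * (1 - u ^ 2)))

lemma measurable_spikeRatio_right (u θ : ℝ) :
    Measurable fun x : ℝ => ENNReal.ofReal (spikeRatio u θ x) := by
  unfold spikeRatio
  fun_prop

lemma spikeRatio_nonneg (u θ x : ℝ) : 0 ≤ spikeRatio u θ x := by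
  unfold spikeRatio
  positivity

lemma gaussianPDFReal_mul_spikeRatio {u : ℝ} (hu : u ^ 2 < 1) (θ x : ℝ) :
    gaussianPDFReal 0 1 x * spikeRatio u θ x =
      gaussianPDFReal (u * θ) (1 - u ^ 2).toNNReal x := by
  have h1 : 0 < 1 - u ^ 2 := by linarith
  rw [gaussianPDFReal_def, gaussianPDFReal_def, spikeRatio, Real.coe_toNNReal _ h1.le]
  have hs : √(2 * Real.pi * (1 - u ^ 2)) = √(2 * Real.pi) * √(1 - u ^ 2) :=
    Real.sqrt_mul (by positivity) _
  simp only [NNReal.coe_one, mul_one, sub_zero, hs, mul_inv]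
  rw [mul_mul_mul_comm, ← Real.exp_add]
  congr 2
  ring

lemma gaussianReal_eq_withDensity_spikeRatio {u : ℝ} (hu : u ^ 2 < 1) (θ : ℝ) :
    gaussianReal (u * θ) (1 - u ^ 2).toNNReal =
      (gaussianReal 0 1).withDensity fun x => ENNReal.ofReal (spikeRatio u θ x) := by
  have h1 : 0 < 1 - u ^ 2 := by linarith
  have hv : (1 - u ^ 2).toNNReal ≠ 0 := by simpa using hu
  rw [gaussianReal_of_var_ne_zero _ hv, gaussianReal_of_var_ne_zero _ one_ne_zero,
    ← withDensity_mul _ (measurable_gaussianPDF _ _) (measurable_spikeRatio_right u θ)]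
  congr 1
  ext x
  simp only [Pi.mul_apply, gaussianPDF]
  rw [← ENNReal.ofReal_mul (gaussianPDFReal_nonneg _ _ _), gaussianPDFReal_mul_spikeRatio hu]

lemma lintegral_spikeRatio {u : ℝ} (hu : u ^ 2 < 1) (θ : ℝ) :
    ∫⁻ x, ENNReal.ofReal (spikeRatio u θ x) ∂gaussianReal 0 1 = 1 := by
  have h := congrArg (fun μ => μ Set.univ) (gaussianReal_eq_withDensity_spikeRatio hu θ)
  simpa using h.symm

/-- Mehler's kernel, the second moment of two likelihood ratios, bounded by an exponential. -/
lemma lintegral_spikeRatio_mul_le {u : ℝ} (hu : u ^ 2 < 1) (θ θ' : ℝ) :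
    ∫⁻ x, ENNReal.ofReal (spikeRatio u θ x) * ENNReal.ofReal (spikeRatio u θ' x)
      ∂gaussianReal 0 1 ≤
    ENNReal.ofReal (Real.exp ((1 - u ^ 4)⁻¹ *
      (u ^ 2 * (θ * θ') - u ^ 4 * ((θ ^ 2 + θ' ^ 2 - 1) / 2)))) := by
  have h1 : 0 < 1 - u ^ 2 := by linarith
  have h2 : 0 < 1 + u ^ 2 := by positivity
  have h4 : 0 < 1 - u ^ 4 := by nlinarith
  -- Completing the square in `x` turns the integrand into `c` times a Gaussian density of this
  -- variance.
  set v : NNReal := ((1 - u ^ 2) / (1 + u ^ 2)).toNNReal with hv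
  have hv' : (v : ℝ) = (1 - u ^ 2) / (1 + u ^ 2) := Real.coe_toNNReal _ (by positivity)
  have hv0 : v ≠ 0 := by
    intro h
    have : (v : ℝ) = 0 := by simp [h]
    rw [hv'] at this
    have : 0 < (1 - u ^ 2) / (1 + u ^ 2) := by positivity
    linarith
  set c : ℝ := (√(1 - u ^ 4))⁻¹ * Real.exp ((1 - u ^ 4)⁻¹ *
      (u ^ 2 * (θ * θ') - u ^ 4 * ((θ ^ 2 + θ' ^ 2) / 2))) with hc
  have hc0 : 0 ≤ c := by positivity
  have hpt : ∀ x, gaussianPDFReal 0 1 x * (spikeRatio u θ x * spikeRatio u θ' x) =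
      c * gaussianPDFReal (u * (θ + θ') / (1 + u ^ 2)) v x := by
    intro x
    rw [gaussianPDFReal_def, gaussianPDFReal_def, spikeRatio, spikeRatio, hv', hc]
    have hs1 : √(1 - u ^ 4) = √(1 - u ^ 2) * √(1 + u ^ 2) := by
      rw [← Real.sqrt_mul h1.le]; congr 1; ring
    have hs2 : √(2 * Real.pi * ((1 - u ^ 2) / (1 + u ^ 2))) =
        √(2 * Real.pi) * (√(1 - u ^ 2) / √(1 + u ^ 2)) := by
      rw [Real.sqrt_mul (by positivity), Real.sqrt_div h1.le]
    have hq1 : √(1 - u ^ 2) ≠ 0 := (Real.sqrt_pos.2 h1).ne'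
    have hq2 : √(1 + u ^ 2) ≠ 0 := (Real.sqrt_pos.2 h2).ne'
    have hq3 : √(2 * Real.pi) ≠ 0 := (Real.sqrt_pos.2 (by positivity)).ne'
    simp only [NNReal.coe_one, mul_one, sub_zero, hs1, hs2]
    have e1 : ∀ a b d e f : ℝ, a * Real.exp b * (d * Real.exp e * (d * Real.exp f)) =
        a * d * d * Real.exp (b + e + f) := by
      intro a b d e f; rw [Real.exp_add, Real.exp_add]; ring
    have e2 : ∀ a b d e : ℝ, a * Real.exp b * (d * Real.exp e) =
        a * d * Real.exp (b + e) := by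
      intro a b d e; rw [Real.exp_add]; ring
    rw [e1, e2]
    congr 1
    · field_simp
    · congr 1
      have h14 : 1 - u ^ 4 = (1 - u ^ 2) * (1 + u ^ 2) := by ring
      rw [h14]
      field_simp
      ring
  calc ∫⁻ x, ENNReal.ofReal (spikeRatio u θ x) * ENNReal.ofReal (spikeRatio u θ' x)
        ∂gaussianReal 0 1
      = ∫⁻ x, ENNReal.ofReal c * gaussianPDF (u * (θ + θ') / (1 + u ^ 2)) v x := by
        rw [gaussianReal_of_var_ne_zero _ one_ne_zero]
        refine (lintegral_withDensity_eq_lintegral_mul _ (measurable_gaussianPDF _ _)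
          ((measurable_spikeRatio_right u θ).mul (measurable_spikeRatio_right u θ'))).trans ?_
        refine lintegral_congr fun x => ?_
        simp only [Pi.mul_apply, gaussianPDF]
        rw [← ENNReal.ofReal_mul (spikeRatio_nonneg _ _ _),
          ← ENNReal.ofReal_mul (gaussianPDFReal_nonneg _ _ _), hpt, ENNReal.ofReal_mul hc0]
    _ = ENNReal.ofReal c := by
        rw [lintegral_const_mul _ (measurable_gaussianPDF _ _),
          lintegral_gaussianPDF_eq_one _ hv0, mul_one]
    _ ≤ _ := by
        apply ENNReal.ofReal_le_ofReal
        -- With `k = (1 - u⁴)⁻¹`, `k = 1 + k u⁴ ≤ exp (k u⁴)`. Moving the prefactor into the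
        -- exponent produces the `-1` next to `θ² + θ'²`.
        have hk : (√(1 - u ^ 4))⁻¹ ≤ Real.exp ((1 - u ^ 4)⁻¹ * (u ^ 4 * (1 / 2))) := by
          have hexp : (1 - u ^ 4)⁻¹ ≤ Real.exp ((1 - u ^ 4)⁻¹ * u ^ 4) := by
            have := Real.add_one_le_exp ((1 - u ^ 4)⁻¹ * u ^ 4)
            have e : (1 - u ^ 4)⁻¹ * u ^ 4 + 1 = (1 - u ^ 4)⁻¹ := by field_simp; ring
            linarith
          rw [← Real.sqrt_inv]
          refine (Real.sqrt_le_sqrt hexp).trans ?_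
          rw [← Real.exp_half]
          apply le_of_eq; congr 1; ring
        calc c ≤ Real.exp ((1 - u ^ 4)⁻¹ * (u ^ 4 * (1 / 2))) * Real.exp ((1 - u ^ 4)⁻¹ *
              (u ^ 2 * (θ * θ') - u ^ 4 * ((θ ^ 2 + θ' ^ 2) / 2))) := by
              rw [hc]; gcongr
          _ = _ := by rw [← Real.exp_add]; congr 1; ring

/-! ### The truncated second moment method. -/

/-- The truncated second moment method: a mixture of densities `M a` with respect to `Q`, with
mixing law `γ`, is close to `Q` if the second moment of the mixture restricted to `a ∈ G` is
close to its minimal value. -/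
lemma abs_mixture_sub_le {α β : Type*} [MeasurableSpace α] [MeasurableSpace β]
    (γ : Measure α) [IsProbabilityMeasure γ] (Q : Measure β) [IsProbabilityMeasure Q]
    {M : α → β → ENNReal} (hMm : Measurable (Function.uncurry M))
    (hM : ∀ a, ∫⁻ b, M a b ∂Q = 1) {G : Set α} (hG : MeasurableSet G) {ε : ℝ} (hε : 0 ≤ ε)
    (h : ∫⁻ a in G, ∫⁻ a' in G, ∫⁻ b, M a b * M a' b ∂Q ∂γ ∂γ ≤
      ENNReal.ofReal (γ.real G ^ 2 + ε))
    {A : Set β} (hA : MeasurableSet A) :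
    |(∫⁻ a, ∫⁻ b in A, M a b ∂Q ∂γ).toReal - Q.real A| ≤ √ε + γ.real Gᶜ := by
  have hMa : ∀ a, Measurable (M a) := fun a => hMm.comp measurable_prodMk_left
  have hMb : ∀ b, Measurable fun a => M a b := fun b => hMm.comp measurable_prodMk_right
  set F : β → ENNReal := fun b => ∫⁻ a in G, M a b ∂γ with hF
  have hFm : Measurable F := by
    have : Measurable (Function.uncurry fun b a => M a b) := hMm.comp measurable_swap
    exact this.lintegral_prod_right'
  have hswap : ∀ (S : Set α) (A : Set β), ∫⁻ a in S, ∫⁻ b in A, M a b ∂Q ∂γ =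
      ∫⁻ b in A, ∫⁻ a in S, M a b ∂γ ∂Q := fun S A =>
    lintegral_lintegral_swap hMm.aemeasurable
  have hle : ∀ (S : Set α) (A : Set β), ∫⁻ a in S, ∫⁻ b in A, M a b ∂Q ∂γ ≤ γ S := by
    intro S A
    calc ∫⁻ a in S, ∫⁻ b in A, M a b ∂Q ∂γ ≤ ∫⁻ a in S, 1 ∂γ :=
          lintegral_mono fun a => (setLIntegral_le_lintegral _ _).trans (hM a).le
      _ = γ S := by simp
  have hFint : ∫⁻ b, F b ∂Q = γ G := by
    have := hswap G Set.univ
    simp only [Measure.restrict_univ, hM] at this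
    rw [hF, ← this]; simp
  have hF2 : ∫⁻ b, F b ^ 2 ∂Q ≤ ENNReal.ofReal (γ.real G ^ 2 + ε) := by
    refine le_trans (le_of_eq ?_) h
    have e1 : ∀ b, F b ^ 2 = ∫⁻ a in G, ∫⁻ a' in G, M a b * M a' b ∂γ ∂γ := by
      intro b
      simp_rw [lintegral_const_mul _ (hMb b)]
      rw [lintegral_mul_const _ (hMb b), sq]
    simp_rw [e1]
    have m1 : Measurable fun p : β × α => ∫⁻ a' in G, M p.2 p.1 * M a' p.1 ∂γ := by
      have : Measurable fun q : (β × α) × α => M q.1.2 q.1.1 * M q.2 q.1.1 :=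
        (hMm.comp ((measurable_snd.comp measurable_fst).prodMk
          (measurable_fst.comp measurable_fst))).mul
        (hMm.comp (measurable_snd.prodMk (measurable_fst.comp measurable_fst)))
      exact this.lintegral_prod_right'
    rw [lintegral_lintegral_swap m1.aemeasurable]
    refine lintegral_congr fun a => ?_
    refine lintegral_lintegral_swap ?_
    exact (((hMa a).comp measurable_fst).mul (hMm.comp measurable_swap)).aemeasurable
  set f : β → ℝ := fun b => (F b).toReal with hf
  have hfm : Measurable f := hFm.ennreal_toReal
  have hFtop : ∀ᵐ b ∂Q, F b < ⊤ := by
    refine ae_lt_top hFm ?_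
    rw [hFint]; exact measure_ne_top _ _
  have hp : ∫ b, f b ∂Q = γ.real G := by
    rw [hf, integral_toReal hFm.aemeasurable hFtop, hFint, Measure.real]
  have hf2 : Integrable (fun b => f b ^ 2) Q ∧ ∫ b, f b ^ 2 ∂Q ≤ γ.real G ^ 2 + ε := by
    have hF2top : ∫⁻ b, F b ^ 2 ∂Q ≠ ⊤ := (hF2.trans_lt ENNReal.ofReal_lt_top).ne
    have e : (fun b => f b ^ 2) = fun b => (F b ^ 2).toReal := by
      ext b; simp [hf]
    rw [e]
    refine ⟨integrable_toReal_of_lintegral_ne_top (hFm.pow_const 2).aemeasurable hF2top, ?_⟩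
    rw [integral_toReal (hFm.pow_const 2).aemeasurable (ae_lt_top (hFm.pow_const 2) hF2top)]
    exact ENNReal.toReal_le_of_le_ofReal (by positivity) hF2
  have hfL : MemLp f 2 Q := (memLp_two_iff_integrable_sq hfm.aestronglyMeasurable).2 hf2.1
  have hfi : Integrable f Q := hfL.integrable (by norm_num)
  set p := γ.real G with hpdef
  have hdL : MemLp (fun b => f b - p) 2 Q := hfL.sub (memLp_const p)
  have hdint : ∫ b, (f b - p) ^ 2 ∂Q ≤ ε := by
    have e : (fun b => (f b - p) ^ 2) = fun b => f b ^ 2 - 2 * p * f b + p ^ 2 := by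
      ext b; ring
    have hi : Integrable (fun b => f b ^ 2 - 2 * p * f b) Q := hf2.1.sub (hfi.const_mul _)
    rw [e, integral_add hi (integrable_const _),
      integral_sub hf2.1 (hfi.const_mul _), integral_const_mul, hp]
    simp only [integral_const, probReal_univ, one_smul]
    nlinarith [hf2.2]
  -- Cauchy–Schwarz, in the form that the variance of the indicator of `A` times `f - p` is
  -- nonnegative.
  have hdA : |∫ b in A, (f b - p) ∂Q| ≤ √ε := by
    refine Real.abs_le_sqrt ?_
    have hvar := variance_nonneg (A.indicator fun b => f b - p) Q
    rw [variance_eq_sub (hdL.indicator hA), integral_indicator hA] at hvar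
    have h2 : ∫ b, ((A.indicator fun b => f b - p) ^ 2) b ∂Q ≤ ∫ b, (f b - p) ^ 2 ∂Q := by
      refine integral_mono ((hdL.indicator hA).integrable_sq) hdL.integrable_sq fun b => ?_
      by_cases hb : b ∈ A
      · simp [hb]
      · simpa [hb] using sq_nonneg (f b - p)
    linarith
  have hAf : ∫ b in A, (f b - p) ∂Q = (∫⁻ b in A, F b ∂Q).toReal - p * Q.real A := by
    rw [integral_sub hfi.integrableOn (integrable_const _), hf,
      integral_toReal hFm.aemeasurable (ae_restrict_of_ae hFtop)]
    simp [mul_comm]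
  have hsplit : ∫⁻ a, ∫⁻ b in A, M a b ∂Q ∂γ =
      (∫⁻ b in A, F b ∂Q) + ∫⁻ a in Gᶜ, ∫⁻ b in A, M a b ∂Q ∂γ := by
    rw [← hswap G A, lintegral_add_compl _ hG]
  have hr := hle Gᶜ A
  have hr0 : (∫⁻ a in Gᶜ, ∫⁻ b in A, M a b ∂Q ∂γ).toReal ≤ γ.real Gᶜ :=
    ENNReal.toReal_mono (measure_ne_top _ _) hr
  have hq : (∫⁻ b in A, F b ∂Q) ≠ ⊤ := by
    rw [← hswap G A]; exact ((hle G A).trans_lt (measure_lt_top _ _)).ne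
  rw [hsplit, ENNReal.toReal_add hq (hr.trans_lt (measure_lt_top _ _)).ne]
  have hpc : γ.real Gᶜ = 1 - p := by rw [probReal_compl_eq_one_sub hG]
  rw [hAf] at hdA
  have hQ1 : Q.real A ≤ 1 := measureReal_le_one
  have hQ0 : 0 ≤ Q.real A := measureReal_nonneg
  have hc0 : 0 ≤ γ.real Gᶜ := measureReal_nonneg
  have hrr0 : 0 ≤ (∫⁻ a in Gᶜ, ∫⁻ b in A, M a b ∂Q ∂γ).toReal := ENNReal.toReal_nonneg
  rw [abs_le] at hdA ⊢
  have hcq : γ.real Gᶜ * Q.real A ≤ γ.real Gᶜ := mul_le_of_le_one_right hc0 hQ1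
  have hcq0 : 0 ≤ γ.real Gᶜ * Q.real A := mul_nonneg hc0 hQ0
  -- The mixture over `Gᶜ` and the missing part of `Q.real A` both lie between `0` and `γ.real Gᶜ`,
  -- so their difference costs that mass only once.
  have hid : Q.real A = p * Q.real A + γ.real Gᶜ * Q.real A := by rw [hpc]; ring
  constructor <;> linarith [hdA.1, hdA.2]

/-! ### Moments of Gaussian monomials. -/

lemma integrable_pow_gaussianReal (k : ℕ) :
    Integrable (fun x : ℝ => x ^ k) (gaussianReal 0 1) := by
  have h := (memLp_id_gaussianReal (μ := 0) (v := 1) k).integrable_norm_pow'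
  refine (integrable_norm_iff (by fun_prop)).1 ?_
  simpa using h

lemma integral_sq_gaussianReal : ∫ x : ℝ, x ^ 2 ∂gaussianReal 0 1 = 1 := by
  have h := variance_fun_id_gaussianReal (μ := 0) (v := 1)
  rw [variance_eq_sub (X := fun x : ℝ => x) (memLp_id_gaussianReal 2)] at h
  simpa using h

lemma integrable_monomial {n : ℕ} (a : Fin n → ℕ) :
    Integrable (fun g : Fin n → ℝ => ∏ i, g i ^ a i) (stdGaussianVec n) :=
  Integrable.fintype_prod fun i => integrable_pow_gaussianReal (a i)

lemma integral_monomial {n : ℕ} (a : Fin n → ℕ) :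
    ∫ g : Fin n → ℝ, ∏ i, g i ^ a i ∂stdGaussianVec n =
      ∏ i, ∫ x : ℝ, x ^ a i ∂gaussianReal 0 1 :=
  integral_fintype_prod_eq_prod fun i x => x ^ a i

/-- The entry of `Δ(g)` at the position `e` above the diagonal. -/
def edgeProd {n : ℕ} (g : Fin n → ℝ) (e : {p : Fin n × Fin n // p.1 < p.2}) : ℝ :=
  g e.1.1 * g e.1.2

lemma prod_pow_indicator {n : ℕ} (g : Fin n → ℝ) (j : Fin n) :
    ∏ i, g i ^ (if i = j then 1 else 0) = g j := by
  simp [pow_ite]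

/-- A product over all coordinates lets the expectation factor into one-dimensional moments. -/
lemma edgeProd_eq_monomial {n : ℕ} (g : Fin n → ℝ) (e : {p : Fin n × Fin n // p.1 < p.2}) :
    edgeProd g e =
      ∏ i, g i ^ ((if i = e.1.1 then 1 else 0) + (if i = e.1.2 then 1 else 0)) := by
  simp only [pow_add, Finset.prod_mul_distrib, prod_pow_indicator, edgeProd]

lemma edgeProd_mul_eq_monomial {n : ℕ} (g : Fin n → ℝ)
    (e f : {p : Fin n × Fin n // p.1 < p.2}) :
    edgeProd g e * edgeProd g f =
      ∏ i, g i ^ (((if i = e.1.1 then 1 else 0) + (if i = e.1.2 then 1 else 0)) +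
        ((if i = f.1.1 then 1 else 0) + (if i = f.1.2 then 1 else 0))) := by
  simp only [pow_add, Finset.prod_mul_distrib, prod_pow_indicator, edgeProd]

lemma integrable_edgeProd {n : ℕ} (e : {p : Fin n × Fin n // p.1 < p.2}) :
    Integrable (fun g : Fin n → ℝ => edgeProd g e) (stdGaussianVec n) := by
  simp_rw [edgeProd_eq_monomial]
  exact integrable_monomial _

lemma integrable_edgeProd_mul {n : ℕ} (e f : {p : Fin n × Fin n // p.1 < p.2}) :
    Integrable (fun g : Fin n → ℝ => edgeProd g e * edgeProd g f) (stdGaussianVec n) := by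
  simp_rw [edgeProd_mul_eq_monomial]
  exact integrable_monomial _

lemma integral_edgeProd {n : ℕ} (e : {p : Fin n × Fin n // p.1 < p.2}) :
    ∫ g : Fin n → ℝ, edgeProd g e ∂stdGaussianVec n = 0 := by
  simp_rw [edgeProd_eq_monomial]
  rw [integral_monomial]
  refine Finset.prod_eq_zero (Finset.mem_univ e.1.1) ?_
  have : e.1.1 ≠ e.1.2 := e.2.ne
  simp [this]

/-- Distinct edges leave some endpoint of `e` outside `f`; that coordinate has exponent one and
kills the expectation. This orthonormality gives `E X² = N`. -/
lemma integral_edgeProd_mul {n : ℕ} (e f : {p : Fin n × Fin n // p.1 < p.2}) :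
    ∫ g : Fin n → ℝ, edgeProd g e * edgeProd g f ∂stdGaussianVec n = if e = f then 1 else 0 := by
  simp_rw [edgeProd_mul_eq_monomial]
  rw [integral_monomial]
  obtain ⟨⟨e1, e2⟩, he⟩ := e
  obtain ⟨⟨f1, f2⟩, hf⟩ := f
  simp only at he hf
  split_ifs with h
  · simp only [Subtype.mk.injEq, Prod.mk.injEq] at h
    obtain ⟨rfl, rfl⟩ := h
    refine Finset.prod_eq_one fun i _ => ?_
    by_cases h1 : i = e1
    · subst h1
      simp [he.ne, integral_sq_gaussianReal]
    · by_cases h2 : i = e2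
      · subst h2
        simp [he.ne', integral_sq_gaussianReal]
      · simp [h1, h2]
  · simp only [Subtype.mk.injEq, Prod.mk.injEq] at h
    by_cases h1 : e1 ≠ f1 ∧ e1 ≠ f2
    · refine Finset.prod_eq_zero (Finset.mem_univ e1) ?_
      simp [he.ne, h1.1, h1.2]
    · have h2 : e2 ≠ f1 ∧ e2 ≠ f2 := by grind
      refine Finset.prod_eq_zero (Finset.mem_univ e2) ?_
      simp [he.ne', h2.1, h2.2]

/-- The power mean inequality; it yields moments of `|g|²` of the right order in `n` without the
chi-square law. -/
lemma sum_sq_pow_le {n : ℕ} (g : Fin n → ℝ) (k : ℕ) :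
    (∑ i, g i ^ 2) ^ (k + 1) ≤ (n : ℝ) ^ k * ∑ i, g i ^ (2 * (k + 1)) := by
  have h := pow_sum_le_card_mul_sum_pow (s := Finset.univ) (f := fun i => g i ^ 2)
    (fun i _ => sq_nonneg _) k
  simpa only [Finset.card_univ, Fintype.card_fin, ← pow_mul] using h

lemma integrable_eval_pow {n : ℕ} (i : Fin n) (k : ℕ) :
    Integrable (fun g : Fin n → ℝ => g i ^ k) (stdGaussianVec n) :=
  integrable_comp_eval (μ := fun _ : Fin n => gaussianReal 0 1) (i := i)
    (integrable_pow_gaussianReal k)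

lemma integral_eval_pow {n : ℕ} (i : Fin n) (k : ℕ) :
    ∫ g : Fin n → ℝ, g i ^ k ∂stdGaussianVec n = ∫ x : ℝ, x ^ k ∂gaussianReal 0 1 :=
  integral_comp_eval (μ := fun _ : Fin n => gaussianReal 0 1) (i := i)
    (f := fun x : ℝ => x ^ k) (by fun_prop)

lemma integrable_sum_sq_pow (n k : ℕ) :
    Integrable (fun g : Fin n → ℝ => (∑ i, g i ^ 2) ^ (k + 1)) (stdGaussianVec n) := by
  refine Integrable.mono' (g := fun g => (n : ℝ) ^ k * ∑ i, g i ^ (2 * (k + 1)))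
    ((integrable_finsetSum _ fun i _ => integrable_eval_pow i _).const_mul _)
    (by fun_prop : Measurable fun g : Fin n → ℝ =>
      (∑ i, g i ^ 2) ^ (k + 1)).aestronglyMeasurable ?_
  filter_upwards with g
  rw [Real.norm_of_nonneg (by positivity)]
  exact sum_sq_pow_le g k

lemma integral_sum_sq_pow_le (n k : ℕ) :
    ∫ g : Fin n → ℝ, (∑ i, g i ^ 2) ^ (k + 1) ∂stdGaussianVec n ≤
      (n : ℝ) ^ (k + 1) * ∫ x : ℝ, x ^ (2 * (k + 1)) ∂gaussianReal 0 1 := by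
  have hi : Integrable (fun g : Fin n → ℝ => ∑ i, g i ^ (2 * (k + 1))) (stdGaussianVec n) :=
    integrable_finsetSum _ fun i _ => integrable_eval_pow i _
  calc ∫ g : Fin n → ℝ, (∑ i, g i ^ 2) ^ (k + 1) ∂stdGaussianVec n
      ≤ ∫ g : Fin n → ℝ, (n : ℝ) ^ k * ∑ i, g i ^ (2 * (k + 1)) ∂stdGaussianVec n :=
        integral_mono (integrable_sum_sq_pow n k) (hi.const_mul _) fun g => sum_sq_pow_le g k
    _ = _ := by
        rw [integral_const_mul, integral_finsetSum _ fun i _ => integrable_eval_pow i _]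
        simp_rw [integral_eval_pow]
        rw [Finset.sum_const, Finset.card_univ, Fintype.card_fin, nsmul_eq_mul]
        ring

/-! ### Gaussian linear forms, a Taylor bound and sums over edges. -/

/-- A linear form of a standard Gaussian vector is a centred Gaussian variable. -/
lemma lintegral_linear_stdGaussianVec {n : ℕ} (a : Fin n → ℝ) {f : ℝ → ENNReal}
    (hf : Measurable f) :
    ∫⁻ g, f (∑ i, g i * a i) ∂stdGaussianVec n =
      ∫⁻ z, f (√(∑ i, a i ^ 2) * z) ∂gaussianReal 0 1 := by
  set L : StrongDual ℝ (EuclideanSpace ℝ (Fin n)) := innerSL ℝ (WithLp.toLp 2 a) with hL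
  have h1 : (stdGaussianVec n).map (fun g => ∑ i, g i * a i) =
      (stdGaussian (EuclideanSpace ℝ (Fin n))).map L := by
    rw [← map_pi_eq_stdGaussian, Measure.map_map (by fun_prop) (by fun_prop), stdGaussianVec]
    congr 1
  have hn : ‖L‖ ^ 2 = ∑ i, a i ^ 2 := by
    rw [hL, innerSL_apply_norm, EuclideanSpace.norm_sq_eq]
    simp
  have h2 : (stdGaussianVec n).map (fun g => ∑ i, g i * a i) =
      (gaussianReal 0 1).map (fun z => √(∑ i, a i ^ 2) * z) := by
    rw [h1, IsGaussian.map_eq_gaussianReal, integral_strongDual_stdGaussian,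
      variance_dual_stdGaussian, gaussianReal_map_const_mul, hn]
    congr 1
    · simp
    have h0 : 0 ≤ ∑ i, a i ^ 2 := Finset.sum_nonneg fun i _ => sq_nonneg _
    ext
    simp [Real.sq_sqrt h0, h0]
  rw [← lintegral_map hf (by fun_prop), h2, lintegral_map hf (by fun_prop)]

/-- For `t ≤ 0` the quadratic polynomial already dominates, since `(1 + t + t²/2)(1 - t + t²/2) = 1
+ t⁴/4`. Thus the remainder requires only an upper bound `v` on the exponent, not one on its
absolute value. -/
lemma exp_le_quadratic_add_cubic {t v : ℝ} (htv : t ≤ v) (hv : 0 ≤ v) :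
    Real.exp t ≤ 1 + (t + t ^ 2 / 2) + v ^ 3 * Real.exp v := by
  rcases le_total 0 t with ht | ht
  · have h := Complex.norm_exp_sub_sum_le_norm_mul_exp (t : ℂ) 3
    have e : Complex.exp t - ∑ m ∈ Finset.range 3, (t : ℂ) ^ m / (m.factorial : ℂ) =
        ((Real.exp t - (1 + t + t ^ 2 / 2) : ℝ) : ℂ) := by
      simp [Finset.sum_range_succ, Nat.factorial]
    rw [e, Complex.norm_real, Complex.norm_real, Real.norm_of_nonneg ht] at h
    have h3 : t ^ 3 * Real.exp t ≤ v ^ 3 * Real.exp v := by gcongr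
    linarith [(abs_le.1 h).2]
  · have h := Real.quadratic_le_exp_of_nonneg (x := -t) (by linarith)
    have h2 : Real.exp t * Real.exp (-t) = 1 := by rw [← Real.exp_add]; simp
    have h4 : 0 ≤ v ^ 3 * Real.exp v := by positivity
    have h5 : Real.exp t ≤ 1 + (t + t ^ 2 / 2) := by
      have h6 : 1 ≤ (1 + (t + t ^ 2 / 2)) * Real.exp (-t) := by
        have h7 : 0 ≤ 1 + (t + t ^ 2 / 2) := by nlinarith [sq_nonneg (t + 1)]
        nlinarith [mul_le_mul_of_nonneg_left h h7, sq_nonneg (t ^ 2)]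
      calc Real.exp t = Real.exp t * 1 := by ring
        _ ≤ Real.exp t * ((1 + (t + t ^ 2 / 2)) * Real.exp (-t)) := by gcongr
        _ = 1 + (t + t ^ 2 / 2) := by linear_combination (1 + (t + t ^ 2 / 2)) * h2
    linarith

lemma two_mul_sum_edges {n : ℕ} (h : Fin n → ℝ) :
    2 * ∑ e : {p : Fin n × Fin n // p.1 < p.2}, h e.1.1 * h e.1.2 + ∑ i, h i ^ 2 =
      (∑ i, h i) ^ 2 := by
  have e1 : ∑ e : {p : Fin n × Fin n // p.1 < p.2}, h e.1.1 * h e.1.2 =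
      ∑ i, ∑ j, if i < j then h i * h j else 0 := by
    rw [← Fintype.sum_prod_type' (f := fun i j => if i < j then h i * h j else 0),
      ← Finset.sum_filter, Finset.sum_subtype (p := fun p : Fin n × Fin n => p.1 < p.2)
        _ (by simp)]
  have e2 : ∑ i, ∑ j, (if i < j then h i * h j else 0) =
      ∑ i, ∑ j, if j < i then h i * h j else 0 := by
    rw [Finset.sum_comm]
    simp_rw [mul_comm]
  have e3 : ∑ i, h i ^ 2 = ∑ i, ∑ j, if i = j then h i * h j else 0 := by
    simp [sq]
  have e4 : (∑ i, h i) ^ 2 = ∑ i, ∑ j, h i * h j := by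
    rw [sq, Finset.sum_mul_sum]
  rw [two_mul, e1]
  nth_rewrite 2 [e2]
  rw [e3, e4]
  simp_rw [← Finset.sum_add_distrib]
  refine Finset.sum_congr rfl fun i _ => Finset.sum_congr rfl fun j _ => ?_
  rcases lt_trichotomy i j with hij | hij | hij
  · simp [hij, hij.ne, hij.not_gt]
  · simp [hij]
  · simp [hij, hij.ne', hij.not_gt]

lemma card_edges_le (n : ℕ) :
    (Fintype.card {p : Fin n × Fin n // p.1 < p.2} : ℝ) ≤ (n : ℝ) ^ 2 := by
  have h := Fintype.card_subtype_le fun p : Fin n × Fin n => p.1 < p.2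
  rw [Fintype.card_prod, Fintype.card_fin] at h
  rw [sq]
  exact_mod_cast h

/-! ### The inner product and squared size of two spikes. -/

/-- The inner product of the upper triangles of `Δ(g)` and `Δ(g')`. -/
noncomputable def spikeInner {n : ℕ} (g g' : Fin n → ℝ) : ℝ :=
  ∑ e : {p : Fin n × Fin n // p.1 < p.2}, edgeProd g e * edgeProd g' e

/-- Half of the sum of squares of the upper triangles of `Δ(g)` and `Δ(g')`, centred by half
its mean. -/
noncomputable def spikeSq {n : ℕ} (g g' : Fin n → ℝ) : ℝ :=
  ∑ e : {p : Fin n × Fin n // p.1 < p.2}, (edgeProd g e ^ 2 + edgeProd g' e ^ 2 - 1) / 2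

/-- Dropping the nonnegative diagonal leaves the square of a form linear in `g'`, hence Gaussian for
fixed `g`. -/
lemma spikeInner_le {n : ℕ} (g g' : Fin n → ℝ) :
    spikeInner g g' ≤ (∑ i, g' i * g i) ^ 2 / 2 := by
  have h := two_mul_sum_edges fun i => g' i * g i
  have h2 : 0 ≤ ∑ i, (g' i * g i) ^ 2 := Finset.sum_nonneg fun i _ => sq_nonneg _
  have e : spikeInner g g' = ∑ e : {p : Fin n × Fin n // p.1 < p.2},
      (g' e.1.1 * g e.1.1) * (g' e.1.2 * g e.1.2) :=
    Finset.sum_congr rfl fun e _ => by unfold edgeProd; ring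
  rw [e]
  linarith

lemma sum_edgeProd_sq_le {n : ℕ} (g : Fin n → ℝ) :
    ∑ e : {p : Fin n × Fin n // p.1 < p.2}, edgeProd g e ^ 2 ≤ (∑ i, g i ^ 2) ^ 2 / 2 := by
  have h := two_mul_sum_edges fun i => g i ^ 2
  have h2 : 0 ≤ ∑ i, (g i ^ 2) ^ 2 := Finset.sum_nonneg fun i _ => sq_nonneg _
  have e : ∑ e : {p : Fin n × Fin n // p.1 < p.2}, edgeProd g e ^ 2 =
      ∑ e : {p : Fin n × Fin n // p.1 < p.2}, g e.1.1 ^ 2 * g e.1.2 ^ 2 :=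
    Finset.sum_congr rfl fun e _ => by unfold edgeProd; ring
  rw [e]
  linarith

lemma spikeSq_eq {n : ℕ} (g g' : Fin n → ℝ) :
    spikeSq g g' = (∑ e : {p : Fin n × Fin n // p.1 < p.2}, edgeProd g e ^ 2 +
      ∑ e : {p : Fin n × Fin n // p.1 < p.2}, edgeProd g' e ^ 2 -
      Fintype.card {p : Fin n × Fin n // p.1 < p.2}) / 2 := by
  simp [spikeSq, ← Finset.sum_div, Finset.sum_add_distrib]

lemma neg_card_le_spikeSq {n : ℕ} (g g' : Fin n → ℝ) :
    -(Fintype.card {p : Fin n × Fin n // p.1 < p.2} : ℝ) / 2 ≤ spikeSq g g' := by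
  rw [spikeSq_eq]
  have h1 : ∀ g : Fin n → ℝ, 0 ≤ ∑ e : {p : Fin n × Fin n // p.1 < p.2}, edgeProd g e ^ 2 :=
    fun g => Finset.sum_nonneg fun e _ => sq_nonneg _
  linarith [h1 g, h1 g']

lemma spikeSq_sq_le {n : ℕ} (g g' : Fin n → ℝ) :
    spikeSq g g' ^ 2 ≤ (n : ℝ) ^ 4 + (∑ i, g i ^ 2) ^ 4 + (∑ i, g' i ^ 2) ^ 4 := by
  have h1 := neg_card_le_spikeSq g g'
  have h2 : spikeSq g g' ≤ ((∑ i, g i ^ 2) ^ 2 + (∑ i, g' i ^ 2) ^ 2) / 4 := by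
    rw [spikeSq_eq]
    have : (0 : ℝ) ≤ Fintype.card {p : Fin n × Fin n // p.1 < p.2} := by positivity
    linarith [sum_edgeProd_sq_le g, sum_edgeProd_sq_le g']
  have h3 := card_edges_le n
  set a := (∑ i, g i ^ 2) ^ 2
  set b := (∑ i, g' i ^ 2) ^ 2
  have ha : 0 ≤ a := sq_nonneg _
  have hb : 0 ≤ b := sq_nonneg _
  have e : (n : ℝ) ^ 4 + (∑ i, g i ^ 2) ^ 4 + (∑ i, g' i ^ 2) ^ 4 =
    ((n : ℝ) ^ 2) ^ 2 + a ^ 2 + b ^ 2 := by ring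
  rw [e]
  set y := spikeSq g g'
  have hn : 0 ≤ (n : ℝ) ^ 2 := by positivity
  have habs : |y| ≤ (n : ℝ) ^ 2 / 2 + (a + b) / 4 := abs_le.2 ⟨by linarith, by linarith⟩
  calc y ^ 2 = |y| ^ 2 := (sq_abs y).symm
    _ ≤ ((n : ℝ) ^ 2 / 2 + (a + b) / 4) ^ 2 := by gcongr
    _ ≤ _ := by nlinarith [sq_nonneg ((n : ℝ) ^ 2 - a), sq_nonneg ((n : ℝ) ^ 2 - b),
                  sq_nonneg (a - b)]

lemma integrable_spikeInner (n : ℕ) :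
    Integrable (fun p : (Fin n → ℝ) × (Fin n → ℝ) => spikeInner p.1 p.2)
      ((stdGaussianVec n).prod (stdGaussianVec n)) :=
  integrable_finsetSum _ fun e _ => (integrable_edgeProd e).mul_prod (integrable_edgeProd e)

lemma integral_spikeInner (n : ℕ) :
    ∫ p : (Fin n → ℝ) × (Fin n → ℝ), spikeInner p.1 p.2
      ∂(stdGaussianVec n).prod (stdGaussianVec n) = 0 := by
  unfold spikeInner
  rw [integral_finsetSum _ fun e _ => (integrable_edgeProd e).mul_prod (integrable_edgeProd e)]
  refine Finset.sum_eq_zero fun e _ => ?_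
  rw [integral_prod_mul (fun g => edgeProd g e) (fun g => edgeProd g e), integral_edgeProd,
    zero_mul]

lemma spikeInner_sq {n : ℕ} (g g' : Fin n → ℝ) :
    spikeInner g g' ^ 2 = ∑ e : {p : Fin n × Fin n // p.1 < p.2},
      ∑ f : {p : Fin n × Fin n // p.1 < p.2},
        (edgeProd g e * edgeProd g f) * (edgeProd g' e * edgeProd g' f) := by
  rw [sq, spikeInner, Finset.sum_mul_sum]
  exact Finset.sum_congr rfl fun e _ => Finset.sum_congr rfl fun f _ => by ring

lemma integrable_spikeInner_sq (n : ℕ) :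
    Integrable (fun p : (Fin n → ℝ) × (Fin n → ℝ) => spikeInner p.1 p.2 ^ 2)
      ((stdGaussianVec n).prod (stdGaussianVec n)) := by
  simp_rw [spikeInner_sq]
  exact integrable_finsetSum _ fun e _ => integrable_finsetSum _ fun f _ =>
    (integrable_edgeProd_mul e f).mul_prod (integrable_edgeProd_mul e f)

lemma integral_spikeInner_sq (n : ℕ) :
    ∫ p : (Fin n → ℝ) × (Fin n → ℝ), spikeInner p.1 p.2 ^ 2
      ∂(stdGaussianVec n).prod (stdGaussianVec n) =
    Fintype.card {p : Fin n × Fin n // p.1 < p.2} := by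
  simp_rw [spikeInner_sq]
  have hi := fun e f : {p : Fin n × Fin n // p.1 < p.2} =>
    (integrable_edgeProd_mul e f).mul_prod (integrable_edgeProd_mul e f)
  rw [integral_finsetSum _ fun e _ => integrable_finsetSum _ fun f _ => hi e f]
  have h : ∀ e f : {p : Fin n × Fin n // p.1 < p.2},
      ∫ p : (Fin n → ℝ) × (Fin n → ℝ),
        (edgeProd p.1 e * edgeProd p.1 f) * (edgeProd p.2 e * edgeProd p.2 f)
        ∂(stdGaussianVec n).prod (stdGaussianVec n) = if e = f then 1 else 0 := by
    intro e f
    rw [integral_prod_mul (fun g => edgeProd g e * edgeProd g f)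
      (fun g => edgeProd g e * edgeProd g f), integral_edgeProd_mul]
    simp
  have h' : ∀ e : {p : Fin n × Fin n // p.1 < p.2},
      ∫ p : (Fin n → ℝ) × (Fin n → ℝ), ∑ f : {p : Fin n × Fin n // p.1 < p.2},
        (edgeProd p.1 e * edgeProd p.1 f) * (edgeProd p.2 e * edgeProd p.2 f)
        ∂(stdGaussianVec n).prod (stdGaussianVec n) = 1 := by
    intro e
    rw [integral_finsetSum _ fun f _ => hi e f]
    simp [h]
  simp [h']

lemma integrable_edgeProd_sq {n : ℕ} (e : {p : Fin n × Fin n // p.1 < p.2}) :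
    Integrable (fun g : Fin n → ℝ => edgeProd g e ^ 2) (stdGaussianVec n) := by
  simpa only [sq] using integrable_edgeProd_mul e e

lemma integral_edgeProd_sq {n : ℕ} (e : {p : Fin n × Fin n // p.1 < p.2}) :
    ∫ g : Fin n → ℝ, edgeProd g e ^ 2 ∂stdGaussianVec n = 1 := by
  simpa only [sq, if_true] using integral_edgeProd_mul e e

lemma integrable_spikeSq (n : ℕ) :
    Integrable (fun p : (Fin n → ℝ) × (Fin n → ℝ) => spikeSq p.1 p.2)
      ((stdGaussianVec n).prod (stdGaussianVec n)) :=
  integrable_finsetSum _ fun e _ => ((((integrable_edgeProd_sq e).comp_fst _).add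
    ((integrable_edgeProd_sq e).comp_snd _)).sub (integrable_const 1)).div_const 2

lemma integral_spikeSq (n : ℕ) :
    ∫ p : (Fin n → ℝ) × (Fin n → ℝ), spikeSq p.1 p.2
      ∂(stdGaussianVec n).prod (stdGaussianVec n) =
    Fintype.card {p : Fin n × Fin n // p.1 < p.2} / 2 := by
  have hi : ∀ e : {p : Fin n × Fin n // p.1 < p.2},
      Integrable (fun p : (Fin n → ℝ) × (Fin n → ℝ) => edgeProd p.1 e ^ 2 + edgeProd p.2 e ^ 2)
        ((stdGaussianVec n).prod (stdGaussianVec n)) := fun e =>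
    ((integrable_edgeProd_sq e).comp_fst _).add ((integrable_edgeProd_sq e).comp_snd _)
  have h : ∀ e : {p : Fin n × Fin n // p.1 < p.2},
      ∫ p : (Fin n → ℝ) × (Fin n → ℝ), (edgeProd p.1 e ^ 2 + edgeProd p.2 e ^ 2 - 1) / 2
        ∂(stdGaussianVec n).prod (stdGaussianVec n) = 1 / 2 := by
    intro e
    rw [integral_div, integral_sub (hi e) (integrable_const 1),
      integral_add ((integrable_edgeProd_sq e).comp_fst _) ((integrable_edgeProd_sq e).comp_snd _),
      integral_fun_fst (fun g => edgeProd g e ^ 2), integral_fun_snd (fun g => edgeProd g e ^ 2),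
      integral_edgeProd_sq]
    simp
  have hi2 : ∀ e : {p : Fin n × Fin n // p.1 < p.2},
      Integrable (fun p : (Fin n → ℝ) × (Fin n → ℝ) =>
        (edgeProd p.1 e ^ 2 + edgeProd p.2 e ^ 2 - 1) / 2)
        ((stdGaussianVec n).prod (stdGaussianVec n)) := fun e =>
    ((hi e).sub (integrable_const 1)).div_const 2
  unfold spikeSq
  rw [integral_finsetSum _ fun e _ => hi2 e]
  simp_rw [h]
  simp [div_eq_mul_inv]

/-- A dominating function for the square of `spikeSq`. -/
noncomputable def spikeSqBound {n : ℕ} (g g' : Fin n → ℝ) : ℝ :=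
  (n : ℝ) ^ 4 + (∑ i, g i ^ 2) ^ 4 + (∑ i, g' i ^ 2) ^ 4

lemma integrable_spikeSqBound (n : ℕ) :
    Integrable (fun p : (Fin n → ℝ) × (Fin n → ℝ) => spikeSqBound p.1 p.2)
      ((stdGaussianVec n).prod (stdGaussianVec n)) :=
  ((integrable_const _).add ((integrable_sum_sq_pow n 3).comp_fst _)).add
    ((integrable_sum_sq_pow n 3).comp_snd _)

lemma integral_spikeSqBound_le (n : ℕ) :
    ∫ p : (Fin n → ℝ) × (Fin n → ℝ), spikeSqBound p.1 p.2
      ∂(stdGaussianVec n).prod (stdGaussianVec n) ≤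
    (1 + 2 * ∫ x : ℝ, x ^ 8 ∂gaussianReal 0 1) * (n : ℝ) ^ 4 := by
  have h1 : Integrable (fun p : (Fin n → ℝ) × (Fin n → ℝ) => (∑ i, p.1 i ^ 2) ^ 4)
      ((stdGaussianVec n).prod (stdGaussianVec n)) := (integrable_sum_sq_pow n 3).comp_fst _
  have h2 : Integrable (fun p : (Fin n → ℝ) × (Fin n → ℝ) => (∑ i, p.2 i ^ 2) ^ 4)
      ((stdGaussianVec n).prod (stdGaussianVec n)) := (integrable_sum_sq_pow n 3).comp_snd _
  have h0 : Integrable (fun p : (Fin n → ℝ) × (Fin n → ℝ) =>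
      (n : ℝ) ^ 4 + (∑ i, p.1 i ^ 2) ^ 4)
      ((stdGaussianVec n).prod (stdGaussianVec n)) := (integrable_const _).add h1
  unfold spikeSqBound
  rw [integral_add h0 h2, integral_add (integrable_const _) h1,
    integral_fun_fst (fun g : Fin n → ℝ => (∑ i, g i ^ 2) ^ 4),
    integral_fun_snd (fun g : Fin n → ℝ => (∑ i, g i ^ 2) ^ 4)]
  have h := integral_sum_sq_pow_le n 3
  norm_num at h ⊢
  linarith

/-! ### Exponential moments of a squared Gaussian. -/

lemma pow_six_mul_exp_le (z : ℝ) :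
    (1 + z ^ 6) * Real.exp (z ^ 2 / 8) ≤ 3073 * Real.exp (z ^ 2 / 4) := by
  have h1 := Real.pow_div_factorial_le_exp (z ^ 2 / 8) (by positivity) 3
  have h2 : 1 ≤ Real.exp (z ^ 2 / 8) := Real.one_le_exp (by positivity)
  -- `3072 = 8³ · 3!` comes from the cubic term of the exponential series, plus one for the
  -- constant.
  have h3 : 1 + z ^ 6 ≤ 3073 * Real.exp (z ^ 2 / 8) := by
    norm_num [Nat.factorial] at h1
    ring_nf at h1 h2 ⊢
    linarith
  calc (1 + z ^ 6) * Real.exp (z ^ 2 / 8)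
      ≤ 3073 * Real.exp (z ^ 2 / 8) * Real.exp (z ^ 2 / 8) := by gcongr
    _ = _ := by rw [mul_assoc, ← Real.exp_add]; ring_nf

lemma lintegral_exp_sq_div_four :
    ∫⁻ z : ℝ, ENNReal.ofReal (Real.exp (z ^ 2 / 4)) ∂gaussianReal 0 1 = ENNReal.ofReal √2 := by
  rw [gaussianReal_of_var_ne_zero _ one_ne_zero]
  refine (lintegral_withDensity_eq_lintegral_mul _ (measurable_gaussianPDF _ _)
    (by fun_prop)).trans ?_
  have h : ∀ z : ℝ, (gaussianPDF 0 1 * fun z : ℝ => ENNReal.ofReal (Real.exp (z ^ 2 / 4))) z =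
      ENNReal.ofReal √2 * gaussianPDF 0 2 z := by
    intro z
    simp only [Pi.mul_apply, gaussianPDF]
    rw [← ENNReal.ofReal_mul (gaussianPDFReal_nonneg _ _ _),
      ← ENNReal.ofReal_mul (by positivity), gaussianPDFReal_def, gaussianPDFReal_def]
    congr 1
    simp only [NNReal.coe_one, NNReal.coe_ofNat, mul_one, sub_zero]
    rw [Real.sqrt_mul (by positivity) 2, mul_assoc, ← Real.exp_add]
    have : √(2 : ℝ) ≠ 0 := by positivity
    field_simp
    ring_nf
  simp_rw [h]
  rw [lintegral_const_mul _ (measurable_gaussianPDF _ _),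
    lintegral_gaussianPDF_eq_one _ two_ne_zero, mul_one]

lemma lintegral_pow_six_mul_exp_le :
    ∫⁻ z : ℝ, ENNReal.ofReal ((1 + z ^ 6) * Real.exp (z ^ 2 / 8)) ∂gaussianReal 0 1 ≤
      ENNReal.ofReal (3073 * √2) := by
  calc ∫⁻ z : ℝ, ENNReal.ofReal ((1 + z ^ 6) * Real.exp (z ^ 2 / 8)) ∂gaussianReal 0 1
      ≤ ∫⁻ z : ℝ, ENNReal.ofReal 3073 * ENNReal.ofReal (Real.exp (z ^ 2 / 4))
          ∂gaussianReal 0 1 := by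
        refine lintegral_mono fun z => ?_
        rw [← ENNReal.ofReal_mul (by norm_num)]
        exact ENNReal.ofReal_le_ofReal (pow_six_mul_exp_le z)
    _ = _ := by
        rw [lintegral_const_mul _ (by fun_prop), lintegral_exp_sq_div_four,
          ← ENNReal.ofReal_mul (by norm_num)]

/-! ### The truncated second moment. -/

/-- The exponent dominating the second moment of the likelihood ratios of two spikes. -/
noncomputable def spikeExponent {n : ℕ} (r : ℝ) (g g' : Fin n → ℝ) : ℝ :=
  (1 - r ^ 2)⁻¹ * (r * spikeInner g g' - r ^ 2 * spikeSq g g')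

/-- An integrable upper bound for the quadratic Taylor polynomial of `spikeExponent`. -/
noncomputable def spikeTaylor {n : ℕ} (r : ℝ) (g g' : Fin n → ℝ) : ℝ :=
  (1 - r ^ 2)⁻¹ * (r * spikeInner g g' - r ^ 2 * spikeSq g g') +
    ((1 - r ^ 2)⁻¹) ^ 2 / 2 * ((r ^ 2 + r ^ 3 * n) * spikeInner g g' ^ 2 +
      (r ^ 3 / n + r ^ 4) * spikeSqBound g g')

/-- The squared length of a spike is at most `1 / (8 r)`. -/
def shortSpikes (n : ℕ) (r : ℝ) : Set (Fin n → ℝ) := {g | r * ∑ i, g i ^ 2 ≤ 1 / 8}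

lemma measurableSet_shortSpikes (n : ℕ) (r : ℝ) : MeasurableSet (shortSpikes n r) :=
  measurableSet_le (by fun_prop) measurable_const

lemma le_quarter_of_mul_le {n : ℕ} (hn : 0 < n) {r : ℝ} (hr : 0 ≤ r) (hrn : r * n ≤ 1 / 4) :
    r ≤ 1 / 4 := by
  have : (1 : ℝ) ≤ n := by exact_mod_cast hn
  nlinarith

lemma inv_one_sub_sq_bounds {r : ℝ} (hr : 0 ≤ r) (hr4 : r ≤ 1 / 4) :
    1 ≤ (1 - r ^ 2)⁻¹ ∧ (1 - r ^ 2)⁻¹ ≤ 2 ∧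
      (1 - r ^ 2)⁻¹ = 1 + (1 - r ^ 2)⁻¹ * r ^ 2 := by
  have h : 1 / 2 ≤ 1 - r ^ 2 := by nlinarith
  have h0 : 0 < 1 - r ^ 2 := by linarith
  refine ⟨(one_le_inv₀ h0).2 (by nlinarith), ?_, by field_simp; ring⟩
  rw [inv_le_comm₀ h0 (by norm_num)]
  linarith

lemma spikeExponent_taylor_le {n : ℕ} (hn : 0 < n) {r : ℝ} (hr : 0 ≤ r) (g g' : Fin n → ℝ) :
    spikeExponent r g g' + spikeExponent r g g' ^ 2 / 2 ≤ spikeTaylor r g g' := by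
  have hn0 : (0 : ℝ) < n := by exact_mod_cast hn
  unfold spikeExponent spikeTaylor
  set k := (1 - r ^ 2)⁻¹
  set x := spikeInner g g'
  set y := spikeSq g g'
  set w := spikeSqBound g g'
  have hy : y ^ 2 ≤ w := spikeSq_sq_le g g'
  -- The weight `n` balances the two terms: `x²` has mean of order at most `n²` and `w` of order
  -- `n⁴`, so both sides are `O(n³)` and `E (X Y)` need not be computed.
  have hxy : -2 * (x * y) ≤ n * x ^ 2 + w / n := by
    have h1 : -2 * (x * y) ≤ n * x ^ 2 + y ^ 2 / n := by
      have h2 : 0 ≤ (n * x + y) ^ 2 / n := by positivity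
      have h3 : (n * x + y) ^ 2 / n = n * x ^ 2 + 2 * (x * y) + y ^ 2 / n := by
        field_simp; ring
      linarith
    have h4 : y ^ 2 / n ≤ w / n := by gcongr
    linarith
  have h5 : (r * x - r ^ 2 * y) ^ 2 ≤ (r ^ 2 + r ^ 3 * n) * x ^ 2 + (r ^ 3 / n + r ^ 4) * w := by
    have h6 : r ^ 3 * (-2 * (x * y)) ≤ r ^ 3 * (n * x ^ 2 + w / n) := by gcongr
    have h7 : r ^ 4 * y ^ 2 ≤ r ^ 4 * w := by gcongr
    calc (r * x - r ^ 2 * y) ^ 2 = r ^ 2 * x ^ 2 + r ^ 3 * (-2 * (x * y)) + r ^ 4 * y ^ 2 := by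
          ring
      _ ≤ r ^ 2 * x ^ 2 + r ^ 3 * (n * x ^ 2 + w / n) + r ^ 4 * w := by linarith
      _ = _ := by ring
  have h8 := mul_le_mul_of_nonneg_left h5 (by positivity : 0 ≤ k ^ 2 / 2)
  linarith [h8, (by ring : (k * (r * x - r ^ 2 * y)) ^ 2 / 2 = k ^ 2 / 2 * (r * x - r ^ 2 * y) ^ 2)]

lemma integrable_spikeTaylor (n : ℕ) (r : ℝ) :
    Integrable (fun p : (Fin n → ℝ) × (Fin n → ℝ) => spikeTaylor r p.1 p.2)
      ((stdGaussianVec n).prod (stdGaussianVec n)) :=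
  ((((integrable_spikeInner n).const_mul r).sub
    ((integrable_spikeSq n).const_mul (r ^ 2))).const_mul _).add
  ((((integrable_spikeInner_sq n).const_mul _).add
    ((integrable_spikeSqBound n).const_mul _)).const_mul _)

lemma integral_spikeTaylor (n : ℕ) (r : ℝ) :
    ∫ p : (Fin n → ℝ) × (Fin n → ℝ), spikeTaylor r p.1 p.2
      ∂(stdGaussianVec n).prod (stdGaussianVec n) =
    (1 - r ^ 2)⁻¹ * (- (r ^ 2 * (Fintype.card {p : Fin n × Fin n // p.1 < p.2} / 2))) +
    ((1 - r ^ 2)⁻¹) ^ 2 / 2 * ((r ^ 2 + r ^ 3 * n) *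
      Fintype.card {p : Fin n × Fin n // p.1 < p.2} +
      (r ^ 3 / n + r ^ 4) * ∫ p : (Fin n → ℝ) × (Fin n → ℝ), spikeSqBound p.1 p.2
        ∂(stdGaussianVec n).prod (stdGaussianVec n)) := by
  have h1 := (integrable_spikeInner n).const_mul r
  have h2 := (integrable_spikeSq n).const_mul (r ^ 2)
  have h3 := (integrable_spikeInner_sq n).const_mul (r ^ 2 + r ^ 3 * n)
  have h4 := (integrable_spikeSqBound n).const_mul (r ^ 3 / n + r ^ 4)
  have h5 := (h1.sub h2).const_mul (1 - r ^ 2)⁻¹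
  have h6 := (h3.add h4).const_mul (((1 - r ^ 2)⁻¹) ^ 2 / 2)
  refine (integral_add h5 h6).trans ?_
  congr 1
  · rw [integral_const_mul]
    congr 1
    refine (integral_sub h1 h2).trans ?_
    rw [integral_const_mul, integral_const_mul, integral_spikeInner, integral_spikeSq]
    ring
  · rw [integral_const_mul]
    congr 1
    refine (integral_add h3 h4).trans ?_
    rw [integral_const_mul, integral_const_mul, integral_spikeInner_sq]

lemma integral_spikeTaylor_le {n : ℕ} (hn : 0 < n) {r : ℝ} (hr : 0 ≤ r) (hrn : r * n ≤ 1 / 4) :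
    ∫ p : (Fin n → ℝ) × (Fin n → ℝ), spikeTaylor r p.1 p.2
      ∂(stdGaussianVec n).prod (stdGaussianVec n) ≤
    (8 + 8 * ∫ x : ℝ, x ^ 8 ∂gaussianReal 0 1) * (r * n) ^ 3 := by
  have hn1 : (1 : ℝ) ≤ n := by exact_mod_cast hn
  have hr4 := le_quarter_of_mul_le hn hr hrn
  obtain ⟨hk1, hk2, hk⟩ := inv_one_sub_sq_bounds hr hr4
  rw [integral_spikeTaylor]
  have hW := integral_spikeSqBound_le n
  have hm : 0 ≤ ∫ x : ℝ, x ^ 8 ∂gaussianReal 0 1 :=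
    integral_nonneg fun x => (by decide : Even 8).pow_nonneg x
  have hN := card_edges_le n
  set N : ℝ := (Fintype.card {p : Fin n × Fin n // p.1 < p.2} : ℝ) with hNdef
  have hN0 : 0 ≤ N := by positivity
  set W := ∫ p : (Fin n → ℝ) × (Fin n → ℝ), spikeSqBound p.1 p.2
        ∂(stdGaussianVec n).prod (stdGaussianVec n)
  set m := ∫ x : ℝ, x ^ 8 ∂gaussianReal 0 1
  set k := (1 - r ^ 2)⁻¹
  set a : ℝ := (n : ℝ)
  have ha0 : 0 < a := by linarith
  have h2 : k ^ 2 / 2 ≤ 2 := by nlinarith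
  have hra : 0 ≤ r * a := by positivity
  -- The key cancellation: the mean of `Y` offsets the second moment of `X` at order `r² N`, because
  -- `k² - k = k² r²`.
  have e1 : k * (-(r ^ 2 * (N / 2))) + k ^ 2 / 2 * (r ^ 2 * N) = k ^ 2 / 2 * (r ^ 4 * N) := by
    have : k ^ 2 = k + k ^ 2 * r ^ 2 := by
      calc k ^ 2 = k * k := by ring
        _ = k * (1 + k * r ^ 2) := by rw [← hk]
        _ = _ := by ring
    linear_combination (r ^ 2 * N / 2) * this
  have b1 : r ^ 4 * N ≤ (r * a) ^ 3 := by
    calc r ^ 4 * N ≤ r ^ 4 * a ^ 2 := by gcongr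
      _ = r ^ 3 * a ^ 2 * r := by ring
      _ ≤ r ^ 3 * a ^ 2 * a := by gcongr; linarith
      _ = _ := by ring
  have b2 : r ^ 3 * a * N ≤ (r * a) ^ 3 := by
    calc r ^ 3 * a * N ≤ r ^ 3 * a * a ^ 2 := by gcongr
      _ = _ := by ring
  have b3 : (r ^ 3 / a + r ^ 4) * W ≤ 2 * (1 + 2 * m) * (r * a) ^ 3 := by
    calc (r ^ 3 / a + r ^ 4) * W ≤ (r ^ 3 / a + r ^ 4) * ((1 + 2 * m) * a ^ 4) := by gcongr
      _ = (1 + 2 * m) * ((r * a) ^ 3 + (r * a) ^ 3 * (r * a)) := by field_simp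
      _ ≤ (1 + 2 * m) * ((r * a) ^ 3 + (r * a) ^ 3 * 1) := by gcongr; linarith
      _ = _ := by ring
  calc k * (-(r ^ 2 * (N / 2))) + k ^ 2 / 2 * ((r ^ 2 + r ^ 3 * a) * N + (r ^ 3 / a + r ^ 4) * W)
      = k ^ 2 / 2 * (r ^ 4 * N + r ^ 3 * a * N + (r ^ 3 / a + r ^ 4) * W) := by
        linear_combination e1
    _ ≤ k ^ 2 / 2 * ((r * a) ^ 3 + (r * a) ^ 3 + 2 * (1 + 2 * m) * (r * a) ^ 3) := by gcongr
    _ ≤ 2 * ((r * a) ^ 3 + (r * a) ^ 3 + 2 * (1 + 2 * m) * (r * a) ^ 3) := by gcongr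
    _ = _ := by ring

/-- Markov's inequality for the third power of `8 r |g|²`; the third power matches the target order.
-/
lemma measureReal_compl_shortSpikes_le (n : ℕ) {r : ℝ} (hr : 0 ≤ r) :
    (stdGaussianVec n).real (shortSpikes n r)ᶜ ≤
      (512 * ∫ x : ℝ, x ^ 6 ∂gaussianReal 0 1) * (r * n) ^ 3 := by
  have hi := (integrable_sum_sq_pow n 2).const_mul (512 * r ^ 3)
  calc (stdGaussianVec n).real (shortSpikes n r)ᶜ
      = ∫ g, (shortSpikes n r)ᶜ.indicator 1 g ∂stdGaussianVec n :=
        (integral_indicator_one (measurableSet_shortSpikes n r).compl).symm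
    _ ≤ ∫ g : Fin n → ℝ, 512 * r ^ 3 * (∑ i, g i ^ 2) ^ (2 + 1) ∂stdGaussianVec n := by
        refine integral_mono ((integrable_const (1 : ℝ)).indicator
          (measurableSet_shortSpikes n r).compl) hi fun g => ?_
        have hs : 0 ≤ ∑ i, g i ^ 2 := Finset.sum_nonneg fun i _ => sq_nonneg _
        by_cases hg : g ∈ shortSpikes n r
        · simp only [Set.indicator, Set.mem_compl_iff, hg, not_true_eq_false, if_false]
          positivity
        · simp only [Set.indicator, Set.mem_compl_iff, hg, not_false_eq_true, if_true,
            Pi.one_apply]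
          have hg' : 1 / 8 < r * ∑ i, g i ^ 2 := not_le.1 hg
          have h1 : 1 ≤ (8 * (r * ∑ i, g i ^ 2)) ^ 3 := one_le_pow₀ (by linarith)
          linarith [h1, (by ring : (8 * (r * ∑ i, g i ^ 2)) ^ 3 =
            512 * r ^ 3 * (∑ i, g i ^ 2) ^ (2 + 1))]
    _ ≤ 512 * r ^ 3 * ((n : ℝ) ^ (2 + 1) * ∫ x : ℝ, x ^ (2 * (2 + 1)) ∂gaussianReal 0 1) := by
        rw [integral_const_mul]
        gcongr
        exact integral_sum_sq_pow_le n 2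
    _ = _ := by norm_num; ring

lemma spikeExponent_le {n : ℕ} (hn : 0 < n) {r : ℝ} (hr : 0 ≤ r) (hrn : r * n ≤ 1 / 4)
    (g g' : Fin n → ℝ) :
    spikeExponent r g g' ≤ r * (∑ i, g' i * g i) ^ 2 + (r * n) ^ 2 := by
  obtain ⟨hk1, hk2, -⟩ := inv_one_sub_sq_bounds hr (le_quarter_of_mul_le hn hr hrn)
  unfold spikeExponent
  have h1 := spikeInner_le g g'
  have h2 := neg_card_le_spikeSq g g'
  have h3 := card_edges_le n
  have h4 : r * spikeInner g g' - r ^ 2 * spikeSq g g' ≤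
      (r * (∑ i, g' i * g i) ^ 2 + (r * n) ^ 2) / 2 := by
    have h5 := mul_le_mul_of_nonneg_left h1 hr
    have h6 : r ^ 2 * (-(n : ℝ) ^ 2 / 2) ≤ r ^ 2 * spikeSq g g' := by
      gcongr
      linarith
    linarith
  calc (1 - r ^ 2)⁻¹ * (r * spikeInner g g' - r ^ 2 * spikeSq g g')
      ≤ (1 - r ^ 2)⁻¹ * ((r * (∑ i, g' i * g i) ^ 2 + (r * n) ^ 2) / 2) := by gcongr
    _ ≤ 2 * ((r * (∑ i, g' i * g i) ^ 2 + (r * n) ^ 2) / 2) := by gcongr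
    _ = _ := by ring

lemma cubic_mul_exp_le {t b : ℝ} (ht : 0 ≤ t) (ht1 : t ≤ 1 / 8) (hb : 0 ≤ b) (hb1 : b ≤ 1 / 4)
    (z : ℝ) :
    (t * z ^ 2 + b ^ 2) ^ 3 * Real.exp (t * z ^ 2 + b ^ 2) ≤
      12 * (t ^ 3 + b ^ 3) * ((1 + z ^ 6) * Real.exp (z ^ 2 / 8)) := by
  have h1 : Real.exp (t * z ^ 2 + b ^ 2) ≤ 3 * Real.exp (z ^ 2 / 8) := by
    have h2 : Real.exp (b ^ 2) ≤ 3 := by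
      have : b ^ 2 ≤ 1 := by nlinarith
      exact (Real.exp_le_exp.2 this).trans (by linarith [Real.exp_one_lt_d9])
    have h3 : Real.exp (t * z ^ 2) ≤ Real.exp (z ^ 2 / 8) := by
      apply Real.exp_le_exp.2
      nlinarith [sq_nonneg z]
    rw [Real.exp_add, mul_comm]
    gcongr
  have h4 : (t * z ^ 2 + b ^ 2) ^ 3 ≤ 4 * ((t ^ 3 + b ^ 3) * (1 + z ^ 6)) := by
    have h5 := add_pow_le (by positivity : 0 ≤ t * z ^ 2) (by positivity : 0 ≤ b ^ 2) 3
    have h6 : b ^ 6 ≤ b ^ 3 := pow_le_pow_of_le_one hb (by linarith) (by norm_num)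
    have hz : 0 ≤ z ^ 6 := (by decide : Even 6).pow_nonneg z
    have h7 : 0 ≤ t ^ 3 := by positivity
    have h8 : 0 ≤ b ^ 3 * z ^ 6 := by positivity
    norm_num at h5
    linarith [h5, (by ring : (t * z ^ 2) ^ 3 = t ^ 3 * z ^ 6), (by ring : (b ^ 2) ^ 3 = b ^ 6)]
  calc (t * z ^ 2 + b ^ 2) ^ 3 * Real.exp (t * z ^ 2 + b ^ 2)
      ≤ (4 * ((t ^ 3 + b ^ 3) * (1 + z ^ 6))) * (3 * Real.exp (z ^ 2 / 8)) := by gcongr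
    _ = _ := by ring

/-- The contribution of the cubic Taylor remainder to the truncated second moment. -/
lemma lintegral_cubic_remainder_le {n : ℕ} {r : ℝ} (hr : 0 ≤ r) (hrn : r * n ≤ 1 / 4) :
    ∫⁻ g in shortSpikes n r, ∫⁻ g' : Fin n → ℝ,
      ENNReal.ofReal ((r * (∑ i, g' i * g i) ^ 2 + (r * n) ^ 2) ^ 3 *
        Real.exp (r * (∑ i, g' i * g i) ^ 2 + (r * n) ^ 2)) ∂stdGaussianVec n
        ∂stdGaussianVec n ≤
    ENNReal.ofReal (12 * (1 + ∫ x : ℝ, x ^ 6 ∂gaussianReal 0 1) * (3073 * √2) * (r * n) ^ 3) := by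
  have hinner : ∀ g ∈ shortSpikes n r, ∫⁻ g' : Fin n → ℝ,
      ENNReal.ofReal ((r * (∑ i, g' i * g i) ^ 2 + (r * n) ^ 2) ^ 3 *
        Real.exp (r * (∑ i, g' i * g i) ^ 2 + (r * n) ^ 2)) ∂stdGaussianVec n ≤
      ENNReal.ofReal (12 * (r ^ 3 * (∑ i, g i ^ 2) ^ 3 + (r * n) ^ 3)) *
        ENNReal.ofReal (3073 * √2) := by
    intro g hg
    have hs : 0 ≤ ∑ i, g i ^ 2 := Finset.sum_nonneg fun i _ => sq_nonneg _
    rw [lintegral_linear_stdGaussianVec g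
      (f := fun a => ENNReal.ofReal ((r * a ^ 2 + (r * n) ^ 2) ^ 3 *
        Real.exp (r * a ^ 2 + (r * n) ^ 2))) (by fun_prop)]
    calc ∫⁻ z, ENNReal.ofReal ((r * (√(∑ i, g i ^ 2) * z) ^ 2 + (r * n) ^ 2) ^ 3 *
          Real.exp (r * (√(∑ i, g i ^ 2) * z) ^ 2 + (r * n) ^ 2)) ∂gaussianReal 0 1
        ≤ ∫⁻ z, ENNReal.ofReal (12 * (r ^ 3 * (∑ i, g i ^ 2) ^ 3 + (r * n) ^ 3)) *
            ENNReal.ofReal ((1 + z ^ 6) * Real.exp (z ^ 2 / 8)) ∂gaussianReal 0 1 := by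
          refine lintegral_mono fun z => ?_
          rw [← ENNReal.ofReal_mul (by positivity)]
          apply ENNReal.ofReal_le_ofReal
          have h := cubic_mul_exp_le (t := r * ∑ i, g i ^ 2) (by positivity) hg
            (b := r * n) (by positivity) hrn z
          rw [mul_pow r (∑ i, g i ^ 2)] at h
          rw [mul_pow (√_), Real.sq_sqrt hs, ← mul_assoc r]
          exact h
      _ ≤ _ := by
          rw [lintegral_const_mul _ (by fun_prop)]
          gcongr
          exact lintegral_pow_six_mul_exp_le
  have hi : Integrable (fun g : Fin n → ℝ => 12 * (r ^ 3 * (∑ i, g i ^ 2) ^ 3 + (r * n) ^ 3))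
      (stdGaussianVec n) :=
    (((integrable_sum_sq_pow n 2).const_mul (r ^ 3)).add (integrable_const _)).const_mul 12
  have hnn : ∀ g : Fin n → ℝ, 0 ≤ 12 * (r ^ 3 * (∑ i, g i ^ 2) ^ 3 + (r * n) ^ 3) := by
    intro g
    have hs : 0 ≤ ∑ i, g i ^ 2 := Finset.sum_nonneg fun i _ => sq_nonneg _
    positivity
  have hm : 0 ≤ ∫ x : ℝ, x ^ 6 ∂gaussianReal 0 1 :=
    integral_nonneg fun x => (by decide : Even 6).pow_nonneg x
  have hval : ∫ g : Fin n → ℝ, 12 * (r ^ 3 * (∑ i, g i ^ 2) ^ 3 + (r * n) ^ 3)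
      ∂stdGaussianVec n ≤ 12 * (1 + ∫ x : ℝ, x ^ 6 ∂gaussianReal 0 1) * (r * n) ^ 3 := by
    rw [integral_const_mul, integral_add ((integrable_sum_sq_pow n 2).const_mul (r ^ 3))
      (integrable_const _), integral_const_mul]
    have h := mul_le_mul_of_nonneg_left (integral_sum_sq_pow_le n 2) (by positivity : 0 ≤ r ^ 3)
    norm_num at h ⊢
    linarith [h, (by ring : (r * (n : ℝ)) ^ 3 = r ^ 3 * (n : ℝ) ^ 3)]
  calc _ ≤ ∫⁻ g in shortSpikes n r,
        ENNReal.ofReal (12 * (r ^ 3 * (∑ i, g i ^ 2) ^ 3 + (r * n) ^ 3)) *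
        ENNReal.ofReal (3073 * √2) ∂stdGaussianVec n :=
        setLIntegral_mono' (measurableSet_shortSpikes n r) hinner
    _ ≤ ∫⁻ g : Fin n → ℝ, ENNReal.ofReal (12 * (r ^ 3 * (∑ i, g i ^ 2) ^ 3 + (r * n) ^ 3)) *
        ENNReal.ofReal (3073 * √2) ∂stdGaussianVec n := setLIntegral_le_lintegral _ _
    _ ≤ _ := by
        rw [lintegral_mul_const _ (by fun_prop),
          ← ofReal_integral_eq_lintegral_ofReal hi (.of_forall hnn),
          ← ENNReal.ofReal_mul (integral_nonneg hnn)]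
        apply ENNReal.ofReal_le_ofReal
        calc _ ≤ 12 * (1 + ∫ x : ℝ, x ^ 6 ∂gaussianReal 0 1) * (r * n) ^ 3 * (3073 * √2) := by
              gcongr
          _ = _ := by ring

/-- The truncated second moment of the likelihood ratio. -/
lemma exists_truncated_second_moment_le :
    ∃ C : ℝ, 0 ≤ C ∧ ∀ (n : ℕ) (r : ℝ), 0 < n → 0 ≤ r → r * n ≤ 1 / 4 →
      (stdGaussianVec n).real (shortSpikes n r)ᶜ ≤ C * (r * n) ^ 3 ∧
      ∫⁻ g in shortSpikes n r, ∫⁻ g' in shortSpikes n r,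
        ENNReal.ofReal (Real.exp (spikeExponent r g g')) ∂stdGaussianVec n ∂stdGaussianVec n ≤
      ENNReal.ofReal ((stdGaussianVec n).real (shortSpikes n r) ^ 2 + C * (r * n) ^ 3) := by
  set m6 := ∫ x : ℝ, x ^ 6 ∂gaussianReal 0 1 with hm6
  set m8 := ∫ x : ℝ, x ^ 8 ∂gaussianReal 0 1 with hm8
  have h6 : 0 ≤ m6 := integral_nonneg fun x => (by decide : Even 6).pow_nonneg x
  have h8 : 0 ≤ m8 := integral_nonneg fun x => (by decide : Even 8).pow_nonneg x
  refine ⟨512 * m6 + (8 + 8 * m8) + 12 * (1 + m6) * (3073 * √2), by positivity,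
    fun n r hn hr hrn => ⟨?_, ?_⟩⟩
  · refine (measureReal_compl_shortSpikes_le n hr).trans ?_
    gcongr
    have : 0 ≤ (8 + 8 * m8) + 12 * (1 + m6) * (3073 * √2) := by positivity
    linarith
  set γ := stdGaussianVec n with hγ
  set G := shortSpikes n r with hG
  have hGm : MeasurableSet G := measurableSet_shortSpikes n r
  have hGG : MeasurableSet (G ×ˢ G) := hGm.prod hGm
  set B : (Fin n → ℝ) → (Fin n → ℝ) → ℝ := fun g g' => 1 + spikeTaylor r g g' with hB
  have hBi : Integrable (fun p : (Fin n → ℝ) × (Fin n → ℝ) => B p.1 p.2) (γ.prod γ) :=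
    (integrable_const 1).add (integrable_spikeTaylor n r)
  -- `1 + t + t²/2 = ((t + 1)² + 1) / 2`. This lower bound allows the integral outside `G ×ˢ G` to
  -- be subtracted from the total.
  have hBpos : ∀ g g', 1 / 2 ≤ B g g' := by
    intro g g'
    have h := spikeExponent_taylor_le hn hr g g'
    simp only [hB]
    nlinarith [sq_nonneg (spikeExponent r g g' + 1)]
  set V : (Fin n → ℝ) → (Fin n → ℝ) → ℝ := fun g g' =>
    r * (∑ i, g' i * g i) ^ 2 + (r * n) ^ 2 with hV
  have hmain : ∫⁻ g in G, ∫⁻ g' in G, ENNReal.ofReal (B g g') ∂γ ∂γ ≤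
      ENNReal.ofReal (γ.real G ^ 2 + γ.real Gᶜ + (8 + 8 * m8) * (r * n) ^ 3) := by
    have hBm : AEMeasurable (fun p : (Fin n → ℝ) × (Fin n → ℝ) => ENNReal.ofReal (B p.1 p.2))
        ((γ.restrict G).prod (γ.restrict G)) := by
      rw [Measure.prod_restrict]
      exact hBi.aemeasurable.ennreal_ofReal.restrict
    rw [← lintegral_prod (fun p : (Fin n → ℝ) × (Fin n → ℝ) => ENNReal.ofReal (B p.1 p.2)) hBm,
      Measure.prod_restrict, ← ofReal_integral_eq_lintegral_ofReal hBi.integrableOn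
        (.of_forall fun p => by simpa using (by linarith [hBpos p.1 p.2] : 0 ≤ B p.1 p.2))]
    apply ENNReal.ofReal_le_ofReal
    have hadd := integral_add_compl hGG hBi
    have hcomp : (γ.prod γ).real (G ×ˢ G)ᶜ * (1 / 2) ≤
        ∫ p in (G ×ˢ G)ᶜ, B p.1 p.2 ∂γ.prod γ := by
      calc (γ.prod γ).real (G ×ˢ G)ᶜ * (1 / 2) = ∫ p in (G ×ˢ G)ᶜ, (1 / 2 : ℝ) ∂γ.prod γ := by
            simp
        _ ≤ _ := integral_mono (integrable_const _) hBi.integrableOn fun p => hBpos p.1 p.2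
    have htot : ∫ p : (Fin n → ℝ) × (Fin n → ℝ), B p.1 p.2 ∂γ.prod γ ≤
        1 + (8 + 8 * m8) * (r * n) ^ 3 := by
      simp only [hB]
      rw [integral_add (integrable_const 1) (integrable_spikeTaylor n r)]
      have := integral_spikeTaylor_le hn hr hrn
      simp only [integral_const, probReal_univ, smul_eq_mul, mul_one]
      linarith
    have hp : (γ.prod γ).real (G ×ˢ G)ᶜ = 1 - γ.real G ^ 2 := by
      rw [probReal_compl_eq_one_sub hGG, measureReal_prod_prod, sq]
    have hc : γ.real Gᶜ = 1 - γ.real G := probReal_compl_eq_one_sub hGm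
    -- With `p = γ.real G`, `1 - (1 - p²) / 2 = p² + (1 - p) - (1 - p)² / 2`.
    nlinarith [sq_nonneg (1 - γ.real G)]
  calc ∫⁻ g in G, ∫⁻ g' in G, ENNReal.ofReal (Real.exp (spikeExponent r g g')) ∂γ ∂γ
      ≤ ∫⁻ g in G, ∫⁻ g' in G, (ENNReal.ofReal (B g g') +
          ENNReal.ofReal (V g g' ^ 3 * Real.exp (V g g'))) ∂γ ∂γ := by
        refine lintegral_mono fun g => lintegral_mono fun g' => ?_
        have hV0 : 0 ≤ V g g' := by simp only [hV]; positivity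
        have h := exp_le_quadratic_add_cubic (spikeExponent_le hn hr hrn g g') hV0
        have h' := spikeExponent_taylor_le hn hr g g'
        rw [← ENNReal.ofReal_add (by linarith [hBpos g g']) (by positivity)]
        apply ENNReal.ofReal_le_ofReal
        simp only [hB]
        linarith
    -- In the remainder only `g` has to be short, so `g'` is released to the full Gaussian law,
    -- under which `⟨g, g'⟩` is Gaussian.
    _ ≤ ∫⁻ g in G, (∫⁻ g' in G, ENNReal.ofReal (B g g') ∂γ) +
          (∫⁻ g', ENNReal.ofReal (V g g' ^ 3 * Real.exp (V g g')) ∂γ) ∂γ := by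
        refine lintegral_mono fun g => ?_
        have hm : Measurable fun g' => ENNReal.ofReal (V g g' ^ 3 * Real.exp (V g g')) := by
          simp only [hV]; fun_prop
        rw [lintegral_add_right _ hm]
        gcongr
        exact Measure.restrict_le_self
    _ = (∫⁻ g in G, ∫⁻ g' in G, ENNReal.ofReal (B g g') ∂γ ∂γ) +
          ∫⁻ g in G, ∫⁻ g', ENNReal.ofReal (V g g' ^ 3 * Real.exp (V g g')) ∂γ ∂γ := by
        refine lintegral_add_right _ ?_
        have hm : Measurable fun p : (Fin n → ℝ) × (Fin n → ℝ) =>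
            ENNReal.ofReal (V p.1 p.2 ^ 3 * Real.exp (V p.1 p.2)) := by
          simp only [hV]; fun_prop
        exact hm.lintegral_prod_right'
    _ ≤ ENNReal.ofReal (γ.real G ^ 2 + γ.real Gᶜ + (8 + 8 * m8) * (r * n) ^ 3) +
          ENNReal.ofReal (12 * (1 + m6) * (3073 * √2) * (r * n) ^ 3) :=
        add_le_add hmain (lintegral_cubic_remainder_le hr hrn)
    _ ≤ _ := by
        rw [← ENNReal.ofReal_add (by positivity) (by positivity)]
        apply ENNReal.ofReal_le_ofReal
        have := measureReal_compl_shortSpikes_le n hr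
        linarith

/-! ### Total variation and the mixture representation of the spiked law. -/

lemma tvDist_le {Ω : Type*} [MeasurableSpace Ω] {ν μ : Measure Ω} {b : ℝ}
    (h : ∀ A, MeasurableSet A → |ν.real A - μ.real A| ≤ b) : tvDist ν μ ≤ b := by
  have : Nonempty {A : Set Ω // MeasurableSet A} := ⟨⟨∅, .empty⟩⟩
  exact ciSup_le fun A => h A.1 A.2

lemma tvDist_le_one {Ω : Type*} [MeasurableSpace Ω] (ν μ : Measure Ω) [IsProbabilityMeasure ν]
    [IsProbabilityMeasure μ] : tvDist ν μ ≤ 1 := by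
  refine tvDist_le fun A _ => abs_le.2 ⟨?_, ?_⟩ <;>
  linarith [measureReal_le_one (μ := ν) (s := A), measureReal_le_one (μ := μ) (s := A),
    measureReal_nonneg (μ := ν) (s := A), measureReal_nonneg (μ := μ) (s := A)]

lemma tvDist_of_subsingleton {Ω : Type*} [Subsingleton Ω] [MeasurableSpace Ω] (ν μ : Measure Ω)
    [IsProbabilityMeasure ν] [IsProbabilityMeasure μ] : tvDist ν μ ≤ 0 := by
  refine tvDist_le fun A _ => ?_
  rcases A.eq_empty_or_nonempty with rfl | hA
  · simp
  · simp [Subsingleton.eq_univ_of_nonempty hA]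

/-- The density of the entries above the diagonal of `u Δ(g) + √(1 - u²) M'` for given `g`. -/
noncomputable def spikeDensity {n : ℕ} (u : ℝ) (g : Fin n → ℝ)
    (x : {p : Fin n × Fin n // p.1 < p.2} → ℝ) : ENNReal :=
  ∏ e, ENNReal.ofReal (spikeRatio u (edgeProd g e) (x e))

lemma measurable_spikeDensity (n : ℕ) (u : ℝ) :
    Measurable (Function.uncurry (spikeDensity (n := n) u)) := by
  have h : ∀ e : {p : Fin n × Fin n // p.1 < p.2}, Measurable
      fun p : (Fin n → ℝ) × ({p : Fin n × Fin n // p.1 < p.2} → ℝ) =>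
        ENNReal.ofReal (spikeRatio u (edgeProd p.1 e) (p.2 e)) := by
    intro e
    unfold spikeRatio edgeProd
    fun_prop
  exact Finset.measurable_fun_prod Finset.univ fun e _ => h e

lemma lintegral_spikeDensity {n : ℕ} {u : ℝ} (hu : u ^ 2 < 1) (g : Fin n → ℝ) :
    ∫⁻ x, spikeDensity u g x ∂(Measure.pi fun _ => gaussianReal 0 1) = 1 := by
  unfold spikeDensity
  rw [lintegral_pi_prod_eq_prod _ fun e => measurable_spikeRatio_right u (edgeProd g e)]
  exact Finset.prod_eq_one fun e _ => lintegral_spikeRatio hu _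

lemma lintegral_spikeDensity_mul_le {n : ℕ} {u : ℝ} (hu : u ^ 2 < 1) (g g' : Fin n → ℝ) :
    ∫⁻ x, spikeDensity u g x * spikeDensity u g' x ∂(Measure.pi fun _ => gaussianReal 0 1) ≤
      ENNReal.ofReal (Real.exp (spikeExponent (u ^ 2) g g')) := by
  unfold spikeDensity
  simp_rw [← Finset.prod_mul_distrib]
  refine (lintegral_pi_prod_eq_prod _ fun e => (measurable_spikeRatio_right u (edgeProd g e)).mul
    (measurable_spikeRatio_right u (edgeProd g' e))).trans_le ?_
  refine (Finset.prod_le_prod' fun e _ =>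
    lintegral_spikeRatio_mul_le hu (edgeProd g e) (edgeProd g' e)).trans (le_of_eq ?_)
  rw [← ENNReal.ofReal_prod_of_nonneg fun e _ => (Real.exp_pos _).le, ← Real.exp_sum]
  congr 2
  rw [← Finset.mul_sum, Finset.sum_sub_distrib, ← Finset.mul_sum, ← Finset.mul_sum,
    spikeExponent, spikeInner, spikeSq]
  ring_nf

/-- Both laws are thereby images under `symmOfUpper`, so they can be compared on the vectors of
entries above the diagonal, where densities exist. -/
lemma smul_offDiagSpike_add {n : ℕ} (u c : ℝ) (g : Fin n → ℝ)
    (x : {p : Fin n × Fin n // p.1 < p.2} → ℝ) :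
    u • offDiagSpike g + c • symmOfUpper n x =
      symmOfUpper n fun e => u * edgeProd g e + c * x e := by
  ext i j
  simp only [offDiagSpike, symmOfUpper, edgeProd, Matrix.add_apply, Matrix.smul_apply,
    Matrix.sub_apply, Matrix.vecMulVec_apply, Matrix.diagonal_apply, Matrix.diag_apply,
    Matrix.of_apply, smul_eq_mul]
  rcases lt_trichotomy i j with h | h | h
  · simp [h, h.ne]
  · simp [h]
  · simp [h, h.ne', h.not_gt, mul_comm (g i)]

lemma map_affine_pi_gaussian {n : ℕ} {u : ℝ} (hu : u ^ 2 < 1) (g : Fin n → ℝ) :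
    (Measure.pi fun _ : {p : Fin n × Fin n // p.1 < p.2} => gaussianReal 0 1).map
      (fun x e => u * edgeProd g e + √(1 - u ^ 2) * x e) =
    (Measure.pi fun _ : {p : Fin n × Fin n // p.1 < p.2} => gaussianReal 0 1).withDensity
      (spikeDensity u g) := by
  have h1 : 0 ≤ 1 - u ^ 2 := by linarith
  have h : ∀ e, (gaussianReal 0 1).map (fun t => u * edgeProd g e + √(1 - u ^ 2) * t) =
      (gaussianReal 0 1).withDensity
        fun t => ENNReal.ofReal (spikeRatio u (edgeProd g e) t) := by
    intro e
    rw [← gaussianReal_eq_withDensity_spikeRatio hu]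
    have hc : (fun t => u * edgeProd g e + √(1 - u ^ 2) * t) =
        (fun t => u * edgeProd g e + t) ∘ fun t => √(1 - u ^ 2) * t := rfl
    rw [hc, ← Measure.map_map (by fun_prop) (by fun_prop), gaussianReal_map_const_mul,
      gaussianReal_map_const_add]
    congr 1
    · simp
    · ext
      simp [Real.sq_sqrt h1, h1]
  have hprob : ∀ e, IsProbabilityMeasure ((gaussianReal 0 1).withDensity
      fun t => ENNReal.ofReal (spikeRatio u (edgeProd g e) t)) := by
    intro e
    rw [← h e]
    exact Measure.isProbabilityMeasure_map (by fun_prop)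
  have hprob' : ∀ e, IsProbabilityMeasure ((gaussianReal 0 1).map
      (fun t => u * edgeProd g e + √(1 - u ^ 2) * t)) := fun e =>
    Measure.isProbabilityMeasure_map (by fun_prop)
  rw [Measure.pi_map_pi (f := fun e t => u * edgeProd g e + √(1 - u ^ 2) * t)
    fun e => by fun_prop]
  simp_rw [h]
  exact pi_withDensity_eq _ fun e => measurable_spikeRatio_right u (edgeProd g e)

lemma spikedGoeLaw_apply {n : ℕ} {u : ℝ} (hu : u ^ 2 < 1)
    {A : Set (Matrix (Fin n) (Fin n) ℝ)} (hA : MeasurableSet A) :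
    spikedGoeLaw n u A = ∫⁻ g, ∫⁻ x in symmOfUpper n ⁻¹' A, spikeDensity u g x
      ∂(Measure.pi fun _ => gaussianReal 0 1) ∂stdGaussianVec n := by
  have hm := measurable_spikedGoe n u
  rw [spikedGoeLaw, Measure.map_apply hm hA, Measure.prod_apply (hm hA)]
  refine lintegral_congr fun g => ?_
  rw [goeLaw, Measure.map_apply (measurable_symmOfUpper n) (measurable_prodMk_left (hm hA)),
    ← withDensity_apply _ (measurable_symmOfUpper n hA), ← map_affine_pi_gaussian hu,
    Measure.map_apply (by fun_prop) (measurable_symmOfUpper n hA)]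
  congr 1
  ext x
  simp only [Set.mem_preimage, smul_offDiagSpike_add]

lemma exists_tvDist_spikedGoeLaw_le :
    ∃ C : ℝ, 0 ≤ C ∧ ∀ (n : ℕ) (u : ℝ), 0 < n → u ^ 2 * n ≤ 1 / 4 →
      tvDist (spikedGoeLaw n u) (goeLaw n) ≤ √(C * (u ^ 2 * n) ^ 3) + C * (u ^ 2 * n) ^ 3 := by
  obtain ⟨C, hC, h⟩ := exists_truncated_second_moment_le
  refine ⟨C, hC, fun n u hn hun => tvDist_le fun A hA => ?_⟩
  have hu : u ^ 2 < 1 := by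
    linarith [le_quarter_of_mul_le hn (sq_nonneg u) hun]
  obtain ⟨h1, h2⟩ := h n (u ^ 2) hn (sq_nonneg u) hun
  have hmix := abs_mixture_sub_le (stdGaussianVec n)
    (Measure.pi fun _ : {p : Fin n × Fin n // p.1 < p.2} => gaussianReal 0 1)
    (measurable_spikeDensity n u) (lintegral_spikeDensity hu)
    (measurableSet_shortSpikes n (u ^ 2)) (ε := C * (u ^ 2 * n) ^ 3) (by positivity)
    ((lintegral_mono fun g => lintegral_mono fun g' =>
      lintegral_spikeDensity_mul_le hu g g').trans h2) (measurable_symmOfUpper n hA)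
  rw [← spikedGoeLaw_apply hu hA] at hmix
  have hgoe : (goeLaw n).real A =
      (Measure.pi fun _ : {p : Fin n × Fin n // p.1 < p.2} => gaussianReal 0 1).real
        (symmOfUpper n ⁻¹' A) := by
    rw [goeLaw, map_measureReal_apply (measurable_symmOfUpper n) hA]
  rw [hgoe]
  exact hmix.trans (by gcongr)

theorem lemma7 :
    ∃ C : ℝ, 0 < C ∧ ∀ (n : ℕ) (u : ℝ), 0 ≤ u → u ≤ 1 →
      tvDist (spikedGoeLaw n u) (goeLaw n) ≤ C * (u ^ 3 * (n : ℝ) ^ (3 / 2 : ℝ)) := by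
  obtain ⟨C, hC, h⟩ := exists_tvDist_spikedGoeLaw_le
  refine ⟨√C + C + 8, by positivity, fun n u hu0 _ => ?_⟩
  rcases Nat.eq_zero_or_pos n with rfl | hn
  · exact (tvDist_of_subsingleton _ _).trans (by positivity)
  set w := u ^ 3 * (n : ℝ) ^ (3 / 2 : ℝ) with hw
  have hw0 : 0 ≤ w := by positivity
  have hw2 : (u ^ 2 * n) ^ 3 = w ^ 2 := by
    have : ((n : ℝ) ^ (3 / 2 : ℝ)) ^ 2 = (n : ℝ) ^ 3 := by
      rw [← Real.rpow_natCast, ← Real.rpow_mul (by positivity), ← Real.rpow_natCast]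
      norm_num
    rw [hw, mul_pow, mul_pow, this]
    ring
  -- Beyond the threshold `w² > 1/64`, so the trivial bound `1 ≤ 8 w` suffices; this is the `8` in
  -- the constant.
  rcases le_or_gt (u ^ 2 * n) (1 / 4) with hun | hun
  · have hw1 : w ≤ 1 := by
      have : (u ^ 2 * (n : ℝ)) ^ 3 ≤ (1 / 4) ^ 3 := by gcongr
      nlinarith
    calc tvDist (spikedGoeLaw n u) (goeLaw n) ≤ √(C * w ^ 2) + C * w ^ 2 := by
          rw [← hw2]; exact h n u hn hun
      _ = √C * w + C * w ^ 2 := by rw [Real.sqrt_mul hC, Real.sqrt_sq hw0]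
      _ ≤ √C * w + C * w := by gcongr; nlinarith
      _ ≤ _ := by linarith
  · have hw1 : 1 ≤ 8 * w := by
      have : (1 / 4) ^ 3 < (u ^ 2 * (n : ℝ)) ^ 3 := by gcongr
      nlinarith
    have : 0 ≤ (√C + C) * w := by positivity
    linarith [tvDist_le_one (spikedGoeLaw n u) (goeLaw n)]
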